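/- Let $\overline M$ be a compact oriented 3-manifold whose boundary is a nonempty union of tori, and let $\tau$ be an ideal triangulation of its interior $M$: a decomposition of $\overline M$ into finitely many truncated tetrahedra, glued in pairs along all their hexagonal faces, so that the truncation triangles (cusp triangles) tile $\partial\overline M$. The degree of an edge of $\tau$ is the number of edges of tetrahedra identified to it. A generalized angle structure on $\tau$ assigns a real number (angle) to each pair of opposite edges of each tetrahedron, so that the three angles of each tetrahedron sum to $\pi$ and the angles around each edge of $\tau$ sum to $2\pi$. It is positive if all angles are $>0$, and taut if all angles lie in $\{0,\pi\}$. Each corner of a cusp triangle carries the angle of the tetrahedron edge through it. For a taut angle structure, the corners at each vertex $v$ of the tiling of $\partial\overline M$ consist of two corners of angle $\pi$ that separate two sequences of consecutive corners of angle $0$, called the fans of $v$. A taut angle structure is veering if for every vertex $v$ either all triangles of the fans of $v$ have their $\pi$-angle immediately before $v$ in the counterclockwise cyclic order on the corners of the triangle, or all of them have it immediately after $v$. **Theorem.** Suppose that $\tau$ is endowed with a veering taut angle structure. Let $d_{\max}$ be the maximum number of triangles in a fan of any vertex of $\partial\overline M$, and let $e_{\max}$ be the largest degree of an edge of $\tau$.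 Then $\tau$ admits a positive angle structure all of whose angles $\theta_i$ satisfy $$\theta_i \;\ge\; \frac{\pi}{12\,d_{\max}^2} \;\ge\; \frac{\pi}{12\,(e_{\max}-3)^2}.$$ -/

import Mathlib

/-!
Oriented ideal triangulations of cusped 3-manifolds, given by face-pairing data, the induced
tiling of the boundary tori, angle structures, and veering structures.

Each tetrahedron has vertices `0, 1, 2, 3` and carries the orientation in which
`(0, 1, 2, 3)` is positively ordered.  Its face `f` is the one opposite the vertex `f`.
-/

namespace VeeringTriangulation

/-- Oriented tetrahedra, indexed by `ι`, glued in pairs along all their faces.  The face `f` of the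
tetrahedron `i` is glued to the face `glue i f f` of the tetrahedron `nbr i f`; the vertex `v ≠ f`
of the first face goes to the vertex `glue i f v` of the second (and, by convention, the vertex `f`
opposite the first face goes to the vertex opposite the second). -/
structure OrientedGluing (ι : Type*) where
  /-- the tetrahedron on the other side of a face -/
  nbr : ι → Fin 4 → ι
  /-- the identification of vertices across a face -/
  glue : ι → Fin 4 → Equiv.Perm (Fin 4)
  /-- gluing is symmetric: the tetrahedra -/
  nbr_nbr : ∀ i f, nbr (nbr i f) (glue i f f) = i
  /-- gluing is symmetric: the vertices -/
  glue_glue : ∀ i f, glue (nbr i f) (glue i f f) = (glue i f)⁻¹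
  /-- no face is glued to itself -/
  not_self : ∀ i f, ¬ (nbr i f = i ∧ glue i f f = f)
  /-- the gluing maps reverse the orientations induced on the faces, so that the orientations of
  the tetrahedra fit together -/
  oriented : ∀ i f, Equiv.Perm.sign (glue i f) = -1

/-- The edges of the unglued tetrahedra: a tetrahedron and an unordered pair of its vertices. -/
abbrev TetEdge (ι : Type*) : Type _ := ι × {s : Sym2 (Fin 4) // ¬ s.IsDiag}

/-- The cusp triangles: `(i, a)` is the triangle obtained by truncating the tip `a` of the
tetrahedron `i`. -/
abbrev CuspTriangle (ι : Type*) : Type _ := ι × Fin 4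

/-- The pairs `(i, (a, b))` with `a ≠ b`.  Such a pair stands for the corner of the cusp triangle
`(i, a)` that lies on the edge `ab` of the tetrahedron `i`, and it is also used for the side of this
cusp triangle opposite that corner, the one that lies in the face `b`. -/
abbrev Corner (ι : Type*) : Type _ := ι × {p : Fin 4 × Fin 4 // p.1 ≠ p.2}

/-- The cusp triangle of a corner. -/
def Corner.triangle {ι : Type*} (x : Corner ι) : CuspTriangle ι := (x.1, x.2.1.1)

namespace OrientedGluing

variable {ι : Type*} (τ : OrientedGluing ι)

/-- The edge `y` is identified with the edge `x` by the gluing along a face containing `x`. -/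
def EdgeStep (x y : TetEdge ι) : Prop :=
  ∃ f : Fin 4, f ∉ x.2.1 ∧ y.1 = τ.nbr x.1 f ∧ y.2.1 = x.2.1.map (τ.glue x.1 f)

/-- The interior edges of the glued manifold: classes of tetrahedron edges under the
equivalence relation generated by the gluing. -/
def Edge : Type _ := Quot τ.EdgeStep

/-- The edge of the manifold on which a tetrahedron edge lies. -/
def edgeOf (x : TetEdge ι) : τ.Edge := Quot.mk _ x

/-- The degree of an edge: the number of tetrahedron edges identified to it. -/
noncomputable def degree (e : τ.Edge) : ℕ := Nat.card {x : TetEdge ι // τ.edgeOf x = e}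

/-- The largest degree of an edge. -/
noncomputable def maxDegree : ℕ := ⨆ e : τ.Edge, τ.degree e

/-- The corners `x` and `y` of two cusp triangles are identified by gluing these triangles along a
side that ends at the corner `x`: in other words, `y` is next to `x` around their common vertex. -/
def CornerStep (x y : Corner ι) : Prop :=
  ∃ f : Fin 4, f ≠ x.2.1.1 ∧ f ≠ x.2.1.2 ∧ y.1 = τ.nbr x.1 f ∧
    y.2.1.1 = τ.glue x.1 f x.2.1.1 ∧ y.2.1.2 = τ.glue x.1 f x.2.1.2

/-- The vertices of the tiling of the boundary by cusp triangles. -/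
def CuspVertex : Type _ := Quot τ.CornerStep

/-- The vertex of the boundary at a given corner of a cusp triangle. -/
def cuspVertexOf (x : Corner ι) : τ.CuspVertex := Quot.mk _ x

/-- The sides `x` and `y` of two cusp triangles are glued to each other. -/
def SideStep (x y : Corner ι) : Prop :=
  y.1 = τ.nbr x.1 x.2.1.2 ∧ y.2.1.1 = τ.glue x.1 x.2.1.2 x.2.1.1 ∧
    y.2.1.2 = τ.glue x.1 x.2.1.2 x.2.1.2

/-- The cusp edges, that is, the edges of the tiling of the boundary by cusp triangles. -/
def CuspEdge : Type _ := Quot τ.SideStep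

/-- The cusp edge on which a side of a cusp triangle lies. -/
def cuspEdgeOf (x : Corner ι) : τ.CuspEdge := Quot.mk _ x

/-- The cusp triangles `x` and `y` are glued along a side. -/
def TriangleStep (x y : CuspTriangle ι) : Prop :=
  ∃ f : Fin 4, f ≠ x.2 ∧ y.1 = τ.nbr x.1 f ∧ y.2 = τ.glue x.1 f x.2

/-- The connected components of the boundary. -/
def BoundaryComponent : Type _ := Quot τ.TriangleStep

/-- The boundary component of a cusp triangle. -/
def componentOf (t : CuspTriangle ι) : τ.BoundaryComponent := Quot.mk _ t

/-- The Euler characteristic, vertices minus edges plus triangles, of a boundary component. -/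
noncomputable def eulerChar (C : τ.BoundaryComponent) : ℤ :=
  (Nat.card {v : τ.CuspVertex //
      ∃ x : Corner ι, τ.cuspVertexOf x = v ∧ τ.componentOf (Corner.triangle x) = C} : ℤ)
    - (Nat.card {s : τ.CuspEdge //
      ∃ x : Corner ι, τ.cuspEdgeOf x = s ∧ τ.componentOf (Corner.triangle x) = C} : ℤ)
    + (Nat.card {t : CuspTriangle ι // τ.componentOf t = C} : ℤ)

end OrientedGluing

/-- An ideal triangulation of (the interior of) an oriented 3-manifold whose boundary is a union of
tori.  The boundary components are closed, connected and oriented, so that they are tori exactly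
when their Euler characteristics vanish. -/
structure IdealTriangulation (ι : Type*) extends OrientedGluing ι where
  /-- all boundary components are tori -/
  torus : ∀ C : toOrientedGluing.BoundaryComponent, toOrientedGluing.eulerChar C = 0

/-- The three pairs of opposite edges of a tetrahedron are numbered `0 = {01, 23}`,
`1 = {02, 13}`, `2 = {03, 12}`; this is the number of the pair that contains the edge `ab`
(and has no meaning for `a = b`). -/
def oppPair (a b : Fin 4) : Fin 3 :=
  (![![0, 0, 1, 2], ![0, 0, 2, 1], ![1, 2, 0, 0], ![2, 1, 0, 0]] : Fin 4 → Fin 4 → Fin 3) a b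

theorem oppPair_comm (a b : Fin 4) : oppPair a b = oppPair b a := by
  revert a b; decide

/-- Two edges have the same number if and only if they are equal or opposite (disjoint). -/
theorem oppPair_eq_iff (a b c d : Fin 4) (hab : a ≠ b) (hcd : c ≠ d) :
    oppPair a b = oppPair c d ↔
      (s(a, b) = s(c, d) ∨ (a ≠ c ∧ a ≠ d ∧ b ≠ c ∧ b ≠ d)) := by
  revert a b c d; decide

/-- The pair of opposite edges that contains a given edge. -/
def pairOf (s : Sym2 (Fin 4)) : Fin 3 := Sym2.lift ⟨oppPair, oppPair_comm⟩ s

/-- An angle vector: one real number for every pair of opposite edges of every tetrahedron. -/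
abbrev AngleVector (ι : Type*) : Type _ := ι → Fin 3 → ℝ

/-- The angle of a cusp triangle at one of its corners, which is the dihedral angle of the
tetrahedron along the edge through this corner. -/
def cornerAngle {ι : Type*} (θ : AngleVector ι) (x : Corner ι) : ℝ :=
  θ x.1 (oppPair x.2.1.1 x.2.1.2)

/-- `a, b, c` are distinct vertices of a tetrahedron, and `c` comes immediately after `b` in the
counterclockwise cyclic order on the three corners of the cusp triangle at `a`: the vertices
`a, b, c` and the remaining one are, in this order, positively ordered. -/
def IsNextCCW (a b c : Fin 4) : Prop :=
  ∃ σ : Equiv.Perm (Fin 4), Equiv.Perm.sign σ = 1 ∧ σ 0 = a ∧ σ 1 = b ∧ σ 2 = c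

namespace IdealTriangulation

variable {ι : Type*} [Fintype ι] (τ : IdealTriangulation ι)

open Classical in
/-- Generalized angle structures: the angles of every tetrahedron sum to `π`, and the angles
around every edge sum to `2π`. -/
structure IsGeneralizedAngleStructure (θ : AngleVector ι) : Prop where
  tetrahedron : ∀ i : ι, ∑ q : Fin 3, θ i q = Real.pi
  edge : ∀ e : τ.Edge,
    ∑ x : TetEdge ι with τ.edgeOf x = e, θ x.1 (pairOf x.2.1) = 2 * Real.pi

/-- Positive angle structures. -/
structure IsPositiveAngleStructure (θ : AngleVector ι) : Prop
    extends τ.IsGeneralizedAngleStructure θ where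
  pos : ∀ i q, 0 < θ i q

/-- Taut angle structures. -/
structure IsTautAngleStructure (α : AngleVector ι) : Prop
    extends τ.IsGeneralizedAngleStructure α where
  taut : ∀ i q, α i q = 0 ∨ α i q = Real.pi

/-- Veering structures: at every vertex `v` of the boundary, either all cusp triangles with a thin
angle at `v` have their `π`-angle immediately before `v` in the counterclockwise order, or all of
them have it immediately after `v`. -/
structure IsVeering (α : AngleVector ι) : Prop extends τ.IsTautAngleStructure α where
  veering : ∀ v : τ.CuspVertex,
    (∀ i a b c, ∀ h : a ≠ b, τ.cuspVertexOf (i, ⟨(a, b), h⟩) = v → α i (oppPair a b) = 0 →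
      IsNextCCW a c b → α i (oppPair a c) = Real.pi) ∨
    (∀ i a b c, ∀ h : a ≠ b, τ.cuspVertexOf (i, ⟨(a, b), h⟩) = v → α i (oppPair a b) = 0 →
      IsNextCCW a b c → α i (oppPair a c) = Real.pi)

/-- The thin corners of a taut angle structure. -/
def ThinCorner (_ : IdealTriangulation ι) (α : AngleVector ι) : Type _ :=
  {x : Corner ι // cornerAngle α x = 0}

/-- The (nonempty) fans of a taut angle structure: the maximal sequences of consecutive thin
corners around the vertices of the boundary. -/
def Fan (α : AngleVector ι) : Type _ :=
  Quot fun x y : τ.ThinCorner α => τ.CornerStep x.1 y.1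

/-- The fan to which a thin corner belongs. -/
def fanOf (α : AngleVector ι) (x : τ.ThinCorner α) : τ.Fan α := Quot.mk _ x

/-- The number of triangles in a fan. -/
noncomputable def fanLength (α : AngleVector ι) (F : τ.Fan α) : ℕ :=
  Nat.card {x : τ.ThinCorner α // τ.fanOf α x = F}

/-- The largest number of triangles in a fan. -/
noncomputable def maxFanLength (α : AngleVector ι) : ℕ := ⨆ F : τ.Fan α, τ.fanLength α F

end IdealTriangulation

end VeeringTriangulation

namespace VeeringTriangulation

open Equiv Equiv.Perm

/-! Any real weights `w` on the edges give a linear deformation of angle vectors: in a positively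
numbered tetrahedron the angle at 01 changes at the rate w(03) + w(12) - w(02) - w(13). The three
rates in a tetrahedron cancel (`sum_deformation`). So do the rates around an edge, because the part
w(03) - w(13) belonging to the face 013 is cancelled by the tetrahedron across that face
(`sum_deformation_edge`). It therefore suffices to find bounded weights for which every zero angle
of the taut structure grows at a definite rate.

Number a tetrahedron so that 03 and 12 carry π, hence 01 is thin (`Valid`). Veering says that the
sign of such a numbering depends only on the edge at 01. This sign is the colour of the edge; 02 and
13 then have the opposite colour. With w = colour · p and p > 0, the rate at 01 is p(02) + p(13) ±
p(03) ± p(12), where a term has the sign + if that π-edge has the colour of 01. If p lies in [1/2,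
1], the rate is at least 1/2 unless both signs are negative. By `mid_iff` that exception occurs
exactly when the frame is neither first nor last in its fan at 01; the fans at 02 and 13 then have
length one.

For these interior frames p(02) + p(13) must exceed p(03) + p(12). To this end each interior frame
gets a height, which accumulates the remaining lengths of the crossing fans at the opposite edges.
One step along a crossing fan shortens what remains of it by one, so the height has a strict mixed
second difference (`midHeight_convex`). The weight of an edge adds the heights belonging to its fans
of length one. Four of the convexity inequalities add up to `weight_convex`, with gap 4. Writing d
for the longest fan length, weights are at most 4d², so p = 1/2 + weight/(8d²) stays in [1/2, 1] and
thin angles grow at rate at least 1/(2d²). Flat angles shrink at rate at most 4, so moving for time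
π/6 gives the bound.

For the degree: two π-angles at an edge are never adjacent (`not_flat_rot`), so besides a longest
fan the edge meets two π-angles and at least one further thin angle. -/

theorem inv_apply_apply {α : Type*} (f : Perm α) (x : α) : f⁻¹ (f x) = x := by simp

theorem apply_inv_apply {α : Type*} (f : Perm α) (x : α) : f (f⁻¹ x) = x := by simp

/-- A frame `(i, P)` is a tetrahedron together with a numbering `P 0, P 1, P 2, P 3` of its
vertices.  It is thought of as sitting at the edge `P 0 P 1`, at the tip `P 0`. -/
abbrev Frame (ι : Type*) : Type _ := ι × Equiv.Perm (Fin 4)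

/-! ### Numbered tetrahedra and their symmetries. -/

namespace Frame

variable {ι : Type*}

/-- Renumber the vertices of a frame. -/
def relabel (π : Perm (Fin 4)) (X : Frame ι) : Frame ι := (X.1, X.2 * π)

theorem relabel_relabel (π ρ : Perm (Fin 4)) (X : Frame ι) :
    relabel π (relabel ρ X) = relabel (ρ * π) X := by
  simp [relabel, mul_assoc]

@[simp] theorem relabel_one (X : Frame ι) : relabel 1 X = X := by simp [relabel]

theorem relabel_inj {π ρ : Perm (Fin 4)} {X : Frame ι} (h : relabel π X = relabel ρ X) : π = ρ := by
  simpa [relabel] using h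

theorem relabel_injective (π : Perm (Fin 4)) : Function.Injective (relabel (ι := ι) π) := by
  intro X Y h
  simpa [relabel, Prod.ext_iff] using h

/-- The sign of the numbering of a frame. -/
def sgn (X : Frame ι) : ℤˣ := sign X.2

@[simp] theorem sgn_relabel (π : Perm (Fin 4)) (X : Frame ι) :
    (relabel π X).sgn = X.sgn * sign π := by simp [sgn, relabel]

/-- The edge of the tetrahedron at which a frame sits. -/
def tetEdge (X : Frame ι) : TetEdge ι :=
  (X.1, ⟨s(X.2 0, X.2 1), by simp⟩)

/-- The corner of the cusp triangle at which a frame sits. -/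
def corner (X : Frame ι) : Corner ι := (X.1, ⟨(X.2 0, X.2 1), by simp⟩)

theorem tetEdge_relabel (π : Perm (Fin 4)) (h : s(π 0, π 1) = s(0, 1)) (X : Frame ι) :
    (relabel π X).tetEdge = X.tetEdge := by
  have : s((X.2 * π) 0, (X.2 * π) 1) = s(X.2 0, X.2 1) := by
    simpa using congrArg (Sym2.map X.2) h
  simp only [tetEdge, relabel, this]

theorem exists_tetEdge (x : TetEdge ι) : ∃ X : Frame ι, X.tetEdge = x := by
  obtain ⟨i, s, hs⟩ := x
  have : ∀ s : Sym2 (Fin 4), ¬ s.IsDiag → ∃ P : Perm (Fin 4), s(P 0, P 1) = s := by decide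
  obtain ⟨P, hP⟩ := this s hs
  exact ⟨(i, P), by simp [tetEdge, hP]⟩

theorem exists_corner (x : Corner ι) : ∃ X : Frame ι, X.corner = x := by
  obtain ⟨i, p, hp⟩ := x
  have : ∀ p : Fin 4 × Fin 4, p.1 ≠ p.2 → ∃ P : Perm (Fin 4), (P 0, P 1) = p := by decide
  obtain ⟨P, hP⟩ := this p hp
  exact ⟨(i, P), by simp [corner, hP]⟩

/-- The frame at the same edge, seen from the other tip, with the same sign. -/
abbrev flip (X : Frame ι) : Frame ι := relabel (swap 0 1 * swap 2 3) X

/-- The frame at the same corner with the opposite sign. -/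
abbrev mirror (X : Frame ι) : Frame ι := relabel (swap 2 3) X

theorem corner_mirror (X : Frame ι) : (mirror X).corner = X.corner := by
  simp [corner, relabel, swap_apply_of_ne_of_ne]

theorem tetEdge_eq_iff {X Y : Frame ι} (h : X.sgn = Y.sgn) :
    X.tetEdge = Y.tetEdge ↔ X = Y ∨ X = flip Y := by
  constructor
  · obtain ⟨i, P⟩ := X
    obtain ⟨j, Q⟩ := Y
    intro h'
    have hij : i = j := congrArg Prod.fst h'
    have hs : s(P 0, P 1) = s(Q 0, Q 1) := congrArg (fun x => x.2.1) h'
    have key : ∀ R : Perm (Fin 4), sign R = 1 → s(R 0, R 1) = s(0, 1) →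
        R = 1 ∨ R = swap 0 1 * swap 2 3 := by decide
    have h1 : sign (Q⁻¹ * P) = 1 := by
      simp only [sgn] at h
      simp [h]
    have h2 : s((Q⁻¹ * P) 0, (Q⁻¹ * P) 1) = s(0, 1) := by
      simpa using congrArg (Sym2.map (Q⁻¹ : Perm (Fin 4))) hs
    rcases key _ h1 h2 with h3 | h3
    · left
      rw [inv_mul_eq_one] at h3
      simp [hij, h3]
    · right
      rw [inv_mul_eq_iff_eq_mul] at h3
      simp [hij, h3, relabel]
  · rintro (rfl | rfl)
    · rfl
    · exact tetEdge_relabel _ (by decide) _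

theorem corner_eq_iff {X Y : Frame ι} (h : X.sgn = Y.sgn) :
    X.corner = Y.corner ↔ X = Y := by
  constructor
  · intro hc
    have ht : X.tetEdge = Y.tetEdge := by
      simp only [corner, Prod.mk.injEq, Subtype.mk.injEq] at hc
      simp [tetEdge, hc.1, hc.2.1, hc.2.2]
    rcases (tetEdge_eq_iff h).1 ht with h1 | h1
    · exact h1
    · subst h1
      have h2 : (Y.2 * (swap 0 1 * swap 2 3) : Perm (Fin 4)) 0 = Y.2 0 :=
        congrArg (fun x : Corner ι => x.2.1.1) hc
      exact absurd (Y.2.injective h2) (by decide)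
  · rintro rfl
    rfl

end Frame

open VeeringTriangulation.Frame

/-! ### Rotation of frames around edges and vertices. -/

namespace OrientedGluing

variable {ι : Type*} (τ : OrientedGluing ι)

/-- Carry a frame to the tetrahedron across the face opposite the vertex numbered `k`. -/
def cross (k : Fin 4) (X : Frame ι) : Frame ι :=
  (τ.nbr X.1 (X.2 k), τ.glue X.1 (X.2 k) * X.2)

@[simp] theorem cross_cross (k : Fin 4) (X : Frame ι) : τ.cross k (τ.cross k X) = X := by
  simp [cross, τ.nbr_nbr, τ.glue_glue]

theorem cross_relabel (k : Fin 4) (π : Perm (Fin 4)) (X : Frame ι) :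
    τ.cross k (relabel π X) = relabel π (τ.cross (π k) X) := by
  simp [cross, relabel, mul_assoc]

@[simp] theorem sgn_cross (k : Fin 4) (X : Frame ι) : (τ.cross k X).sgn = - X.sgn := by
  simp [sgn, cross, τ.oriented]

/-- The edge of the manifold at which a frame sits. -/
def edge (X : Frame ι) : τ.Edge := τ.edgeOf X.tetEdge

theorem edge_relabel (π : Perm (Fin 4)) (h : s(π 0, π 1) = s(0, 1)) (X : Frame ι) :
    τ.edge (relabel π X) = τ.edge X := by
  rw [edge, tetEdge_relabel π h, edge]

theorem edgeStep_cross {k : Fin 4} (h0 : k ≠ 0) (h1 : k ≠ 1) (X : Frame ι) :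
    τ.EdgeStep X.tetEdge (τ.cross k X).tetEdge :=
  ⟨X.2 k, by simp [tetEdge, h0, h1], rfl, by simp [tetEdge, cross]⟩

theorem edge_cross {k : Fin 4} (h0 : k ≠ 0) (h1 : k ≠ 1) (X : Frame ι) :
    τ.edge (τ.cross k X) = τ.edge X :=
  (Quot.sound (τ.edgeStep_cross h0 h1 X)).symm

/-- Rotation of the frames around their edges. -/
def rot : Perm (Frame ι) where
  toFun X := mirror (τ.cross 2 X)
  invFun X := mirror (τ.cross 3 X)
  left_inv X := by
    simp only [cross_relabel, relabel_relabel, swap_apply_right, cross_cross]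
    simp
  right_inv X := by
    simp only [cross_relabel, relabel_relabel, swap_apply_left, cross_cross]
    simp

theorem rot_apply (X : Frame ι) : τ.rot X = mirror (τ.cross 2 X) := rfl

theorem rot_inv_apply (X : Frame ι) : τ.rot⁻¹ X = mirror (τ.cross 3 X) := rfl

@[simp] theorem sgn_rot (X : Frame ι) : (τ.rot X).sgn = X.sgn := by
  simp [rot_apply]

@[simp] theorem sgn_rot_inv (X : Frame ι) : (τ.rot⁻¹ X).sgn = X.sgn := by
  simp [rot_inv_apply]

@[simp] theorem edge_rot (X : Frame ι) : τ.edge (τ.rot X) = τ.edge X := by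
  rw [rot_apply, edge_relabel _ _ (by decide), edge_cross _ (by decide) (by decide)]

@[simp] theorem edge_rot_inv (X : Frame ι) : τ.edge (τ.rot⁻¹ X) = τ.edge X := by
  rw [rot_inv_apply, edge_relabel _ _ (by decide), edge_cross _ (by decide) (by decide)]

@[simp] theorem edge_flip (X : Frame ι) : τ.edge (flip X) = τ.edge X :=
  edge_relabel _ _ (by decide) _

@[simp] theorem edge_mirror (X : Frame ι) : τ.edge (mirror X) = τ.edge X :=
  edge_relabel _ _ (by decide) _

theorem rot_flip (X : Frame ι) : τ.rot (flip X) = flip (τ.rot⁻¹ X) := by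
  rw [rot_apply, rot_inv_apply, cross_relabel]
  simp only [relabel_relabel]
  congr 1
  decide

theorem rot_inv_flip (X : Frame ι) : τ.rot⁻¹ (flip X) = flip (τ.rot X) := by
  rw [rot_apply, rot_inv_apply, cross_relabel]
  simp only [relabel_relabel]
  congr 1
  decide

theorem flip_flip (X : Frame ι) : flip (flip X) = X := by
  simp only [relabel_relabel]
  have : (swap 0 1 * swap 2 3 * (swap 0 1 * swap 2 3) : Perm (Fin 4)) = 1 := by decide
  rw [this, relabel_one]

theorem rot_pow_flip (n : ℕ) (X : Frame ι) :
    (τ.rot ^ n) (flip X) = flip ((τ.rot⁻¹ ^ n) X) := by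
  induction n generalizing X with
  | zero => rfl
  | succ n ih => rw [pow_succ, pow_succ, mul_apply, mul_apply, rot_flip, ih]

theorem flip_ne (X : Frame ι) : flip X ≠ X := by
  intro h
  have := relabel_inj (h.trans (relabel_one X).symm)
  revert this
  decide

theorem rot_ne_flip (X : Frame ι) : τ.rot X ≠ flip X := by
  intro h
  rw [rot_apply] at h
  have h' := congrArg mirror h
  simp only [relabel_relabel] at h'
  have e1 : (swap 2 3 * swap 2 3 : Perm (Fin 4)) = 1 := by decide
  have e2 : (swap 0 1 * swap 2 3 * swap 2 3 : Perm (Fin 4)) = swap 0 1 := by decide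
  rw [e1, e2, relabel_one] at h'
  refine τ.not_self X.1 (X.2 2) ⟨congrArg Prod.fst h', ?_⟩
  have := congrArg (fun Y : Frame ι => Y.2 2) h'
  simpa [cross, relabel, swap_apply_of_ne_of_ne] using this

/-- The rotation around an edge does not reverse it. -/
theorem rot_pow_ne_flip (n : ℕ) (X : Frame ι) : (τ.rot ^ n) X ≠ flip X := by
  intro h
  have comm : ∀ k : ℕ, (τ.rot⁻¹ ^ k) (flip X) = flip ((τ.rot ^ k) X) := by
    intro k
    have := τ.rot_pow_flip k (flip X)
    rw [flip_flip] at this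
    generalize (τ.rot⁻¹ ^ k) (flip X) = Y at this
    rw [this, flip_flip]
  -- Since `flip` conjugates the rotation to its inverse, a reversal would have its midpoint either
  -- at a frame fixed by `flip` or between two frames. The latter would glue a face to itself.
  rcases Nat.even_or_odd' n with ⟨k, rfl | rfl⟩
  · apply flip_ne ((τ.rot ^ k) X)
    rw [← comm, ← h, two_mul, pow_add, mul_apply, inv_pow, inv_apply_apply]
  · apply τ.rot_ne_flip ((τ.rot ^ k) X)
    have e : (τ.rot ^ (2 * k + 1)) X = (τ.rot ^ k) ((τ.rot ^ (k + 1)) X) := by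
      rw [← mul_apply, ← pow_add]
      congr 2
      ring
    rw [← comm, ← h, e, inv_pow, inv_apply_apply, pow_succ', mul_apply]

/-- Frames of the same sign at the same edge are obtained from each other by rotation, up to
changing the tip. -/
theorem sameCycle_of_edge_eq {X Y : Frame ι} (he : τ.edge X = τ.edge Y) (hs : X.sgn = Y.sgn) :
    τ.rot.SameCycle X Y ∨ τ.rot.SameCycle X (flip Y) := by
  have flipc : ∀ Z W : Frame ι, τ.rot.SameCycle Z W → τ.rot.SameCycle (flip Z) (flip W) := by
    rintro Z W ⟨n, rfl⟩
    obtain ⟨m, rfl | rfl⟩ := n.eq_nat_or_neg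
    · refine SameCycle.symm ⟨m, ?_⟩
      simp only [zpow_natCast, τ.rot_pow_flip, inv_pow, inv_apply_apply]
    · refine ⟨m, ?_⟩
      simp only [zpow_natCast, τ.rot_pow_flip, inv_pow, zpow_neg, zpow_natCast]
  set C : Frame ι → Frame ι → Prop :=
    fun Z W => τ.rot.SameCycle Z W ∨ τ.rot.SameCycle Z (flip W) with hC
  have Csymm : ∀ Z W, C Z W → C W Z := by
    rintro Z W (h | h)
    · exact Or.inl h.symm
    · right
      have := flipc _ _ h
      rw [flip_flip] at this
      exact this.symm
  have Ctrans : ∀ U Z W, C U Z → C Z W → C U W := by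
    rintro U Z W (h | h) (h' | h')
    · exact Or.inl (h.trans h')
    · exact Or.inr (h.trans h')
    · exact Or.inr (h.trans (flipc _ _ h'))
    · left
      have := flipc _ _ h'
      rw [flip_flip] at this
      exact h.trans this
  have step : ∀ x y, τ.EdgeStep x y → ∀ Z W : Frame ι, Z.tetEdge = x → W.tetEdge = y →
      Z.sgn = W.sgn → C Z W := by
    rintro x y ⟨f, hf, h1, h2⟩ Z W rfl rfl hZW
    have hk : f = Z.2 2 ∨ f = Z.2 3 := by
      obtain ⟨k, rfl⟩ := Z.2.surjective f
      have : k ≠ 0 ∧ k ≠ 1 := by simpa [tetEdge] using hf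
      revert this
      fin_cases k <;> simp
    have aux : ∀ k : Fin 4, f = Z.2 k → ∀ V : Frame ι, V = mirror (τ.cross k Z) →
        τ.rot.SameCycle Z V → C Z W := by
      rintro k rfl V rfl hV
      have ht : (mirror (τ.cross k Z)).tetEdge = W.tetEdge := by
        rw [tetEdge_relabel _ (by decide)]
        refine Prod.ext h1.symm (Subtype.ext ?_)
        rw [h2]
        simp [tetEdge, cross]
      rcases (tetEdge_eq_iff (by simp [hZW])).1 ht with h | h
      · rw [h] at hV
        exact Or.inl hV
      · rw [h] at hV
        exact Or.inr hV
    rcases hk with hk | hk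
    · exact aux 2 hk _ rfl ⟨1, by simp [rot_apply]⟩
    · exact aux 3 hk _ rfl ⟨-1, by simp [← rot_inv_apply]⟩
  have main : ∀ x y, Relation.EqvGen τ.EdgeStep x y → ∀ Z W : Frame ι, Z.tetEdge = x →
      W.tetEdge = y → Z.sgn = W.sgn → C Z W := by
    intro x y h
    induction h with
    | rel x y h => exact step x y h
    | refl x =>
      intro Z W hZ hW hs
      rcases (tetEdge_eq_iff hs).1 (hZ.trans hW.symm) with rfl | rfl
      · exact Or.inl (SameCycle.refl _ _)
      · exact Or.inr (SameCycle.refl _ _)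
    | symm x y _ ih =>
      intro Z W hZ hW hs
      exact Csymm _ _ (ih W Z hW hZ hs.symm)
    | trans x y z _ _ ih1 ih2 =>
      intro Z W hZ hW hs
      obtain ⟨V, hV⟩ := exists_tetEdge y
      -- The intermediate frame is chosen arbitrarily; its mirror image corrects a wrong sign.
      by_cases hsV : V.sgn = Z.sgn
      · exact Ctrans _ _ _ (ih1 Z V hZ hV hsV.symm) (ih2 V W hV hW (hsV.trans hs))
      · have hs' : (mirror V).sgn = Z.sgn := by
          rw [sgn_relabel, sign_swap (by decide), mul_neg_one]
          exact (Int.units_ne_iff_eq_neg.1 (Ne.symm hsV)).symm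
        have hV' : (mirror V).tetEdge = y := by rw [tetEdge_relabel _ (by decide), hV]
        exact Ctrans _ _ _ (ih1 Z _ hZ hV' hs'.symm) (ih2 _ W hV' hW (hs'.trans hs))
  exact main _ _ (Quot.eqvGen_exact he) X Y rfl rfl hs

/-- Corners that are next to each other by rotation. -/
theorem cornerStep_rot (X : Frame ι) : τ.CornerStep X.corner (τ.rot X).corner := by
  rw [rot_apply, corner_mirror]
  exact ⟨X.2 2, by simp [corner], by simp [corner], rfl, rfl, rfl⟩

theorem cornerStep_rot_inv (X : Frame ι) : τ.CornerStep X.corner (τ.rot⁻¹ X).corner := by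
  rw [rot_inv_apply, corner_mirror]
  exact ⟨X.2 3, by simp [corner], by simp [corner], rfl, rfl, rfl⟩

theorem eq_corner_of_cornerStep {X : Frame ι} {y : Corner ι} (h : τ.CornerStep X.corner y) :
    y = (τ.rot X).corner ∨ y = (τ.rot⁻¹ X).corner := by
  obtain ⟨f, hf0, hf1, h1, h2, h3⟩ := h
  rw [rot_apply, rot_inv_apply, corner_mirror, corner_mirror]
  obtain ⟨k, rfl⟩ := X.2.surjective f
  have hk : k = 2 ∨ k = 3 := by
    have : k ≠ 0 ∧ k ≠ 1 := by simpa [corner] using And.intro hf0 hf1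
    revert this
    fin_cases k <;> simp
  rcases hk with rfl | rfl
  · exact Or.inl (Prod.ext h1 (Subtype.ext (Prod.ext h2 h3)))
  · exact Or.inr (Prod.ext h1 (Subtype.ext (Prod.ext h2 h3)))

theorem cornerStep_symm {x y : Corner ι} (h : τ.CornerStep x y) : τ.CornerStep y x := by
  obtain ⟨X, rfl⟩ := exists_corner x
  rcases τ.eq_corner_of_cornerStep h with rfl | rfl
  · simpa using τ.cornerStep_rot_inv (τ.rot X)
  · simpa using τ.cornerStep_rot (τ.rot⁻¹ X)

theorem cuspVertexOf_sameCycle {X Y : Frame ι} (h : τ.rot.SameCycle X Y) :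
    τ.cuspVertexOf X.corner = τ.cuspVertexOf Y.corner := by
  have key : ∀ (n : ℕ) (X : Frame ι),
      τ.cuspVertexOf ((τ.rot ^ n) X).corner = τ.cuspVertexOf X.corner := by
    intro n
    induction n with
    | zero => intro X; rfl
    | succ n ih =>
      intro X
      rw [pow_succ, mul_apply, ih]
      exact (Quot.sound (τ.cornerStep_rot X)).symm
  obtain ⟨n, rfl⟩ := h
  obtain ⟨m, rfl | rfl⟩ := n.eq_nat_or_neg
  · rw [zpow_natCast, key]
  · rw [zpow_neg, zpow_natCast]
    have := key m ((τ.rot ^ m)⁻¹ X)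
    rw [apply_inv_apply] at this
    exact this

end OrientedGluing

theorem oppPair_perm_iff (P : Perm (Fin 4)) {a b c d : Fin 4} (hab : a ≠ b) (hcd : c ≠ d) :
    oppPair (P a) (P b) = oppPair (P c) (P d) ↔ oppPair a b = oppPair c d := by
  rw [oppPair_eq_iff _ _ _ _ (P.injective.ne hab) (P.injective.ne hcd),
    oppPair_eq_iff _ _ _ _ hab hcd]
  simp

/-- A numbering of the vertices of a tetrahedron whose first edge lies in a given pair. -/
def stdPerm (q : Fin 3) : Perm (Fin 4) :=
  (![1, swap 1 2, swap 1 3] : Fin 3 → Perm (Fin 4)) q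

theorem oppPair_stdPerm (q : Fin 3) : oppPair (stdPerm q 0) (stdPerm q 1) = q := by
  revert q; decide

/-! ### Deformations of angle structures from edge weights. -/

namespace OrientedGluing

variable {ι : Type*} (τ : OrientedGluing ι)

theorem edge_relabel_congr {π ρ : Perm (Fin 4)} (h : s(π 0, π 1) = s(ρ 0, ρ 1)) (X : Frame ι) :
    τ.edge (relabel π X) = τ.edge (relabel ρ X) := by
  have e : relabel π X = relabel (ρ⁻¹ * π) (relabel ρ X) := by
    rw [relabel_relabel]; simp
  rw [e]
  apply edge_relabel
  simpa using congrArg (Sym2.map (ρ⁻¹ : Perm (Fin 4))) h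

theorem edge_relabel_cross {π : Perm (Fin 4)} {k : Fin 4} (h0 : π 0 ≠ k) (h1 : π 1 ≠ k)
    (X : Frame ι) : τ.edge (relabel π (τ.cross k X)) = τ.edge (relabel π X) := by
  have e : relabel π (τ.cross k X) = τ.cross (π⁻¹ k) (relabel π X) := by
    rw [cross_relabel]; simp
  rw [e, edge_cross]
  · intro h
    exact h0 (by rw [← h]; simp)
  · intro h
    exact h1 (by rw [← h]; simp)

/-- The rate of change of the angle at a frame when the edges are weighted by `w`. -/
noncomputable def turn (w : τ.Edge → ℝ) (X : Frame ι) : ℝ :=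
  ((X.sgn : ℤ) : ℝ) * (w (τ.edge (relabel (swap 1 3) X)) + w (τ.edge (relabel (swap 0 2) X))
    - w (τ.edge (relabel (swap 1 2) X)) - w (τ.edge (relabel (swap 0 3) X)))

/-- The contribution of one of the two faces at the edge of a frame to `turn`. -/
noncomputable def halfTurn (w : τ.Edge → ℝ) (X : Frame ι) : ℝ :=
  ((X.sgn : ℤ) : ℝ) * (w (τ.edge (relabel (swap 1 3) X)) - w (τ.edge (relabel (swap 0 3) X)))

theorem turn_eq_halfTurn (w : τ.Edge → ℝ) (X : Frame ι) :
    τ.turn w X = τ.halfTurn w X + τ.halfTurn w (mirror X) := by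
  simp only [turn, halfTurn, sgn_relabel, relabel_relabel,
    τ.edge_relabel_congr (show s((swap 2 3 * swap 1 3 : Perm (Fin 4)) 0,
      (swap 2 3 * swap 1 3 : Perm (Fin 4)) 1) = s((swap 1 2 : Perm (Fin 4)) 0,
        (swap 1 2 : Perm (Fin 4)) 1) by decide),
    τ.edge_relabel_congr (show s((swap 2 3 * swap 0 3 : Perm (Fin 4)) 0,
      (swap 2 3 * swap 0 3 : Perm (Fin 4)) 1) = s((swap 0 2 : Perm (Fin 4)) 0,
        (swap 0 2 : Perm (Fin 4)) 1) by decide)]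
  rw [sign_swap (by decide)]
  push_cast
  ring

/-- The edges 03 and 13 both lie in the face being crossed, so their weights persist while the sign
of the numbering changes. -/
theorem halfTurn_cross (w : τ.Edge → ℝ) (X : Frame ι) :
    τ.halfTurn w (τ.cross 2 X) = - τ.halfTurn w X := by
  simp only [halfTurn, sgn_cross]
  rw [τ.edge_relabel_cross (by decide) (by decide), τ.edge_relabel_cross (by decide) (by decide)]
  push_cast
  ring

/-- The renumberings that preserve the pair {01, 23} form a group of order 8, generated by (01),
(23) and (02)(13). Odd ones exchange the two pairs of weights and change the sign. This makes the
rate a function of the pair of opposite edges. -/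
theorem turn_relabel (w : τ.Edge → ℝ) {π : Perm (Fin 4)} (h : oppPair (π 0) (π 1) = 0)
    (X : Frame ι) : τ.turn w (relabel π X) = τ.turn w X := by
  have gen01 : ∀ X : Frame ι, τ.turn w (relabel (swap 0 1) X) = τ.turn w X := by
    intro X
    simp only [turn, sgn_relabel, relabel_relabel,
      τ.edge_relabel_congr (show s((swap 0 1 * swap 1 3 : Perm (Fin 4)) 0,
        (swap 0 1 * swap 1 3 : Perm (Fin 4)) 1) = s((swap 0 3 : Perm (Fin 4)) 0,
          (swap 0 3 : Perm (Fin 4)) 1) by decide),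
      τ.edge_relabel_congr (show s((swap 0 1 * swap 0 2 : Perm (Fin 4)) 0,
        (swap 0 1 * swap 0 2 : Perm (Fin 4)) 1) = s((swap 1 2 : Perm (Fin 4)) 0,
          (swap 1 2 : Perm (Fin 4)) 1) by decide),
      τ.edge_relabel_congr (show s((swap 0 1 * swap 1 2 : Perm (Fin 4)) 0,
        (swap 0 1 * swap 1 2 : Perm (Fin 4)) 1) = s((swap 0 2 : Perm (Fin 4)) 0,
          (swap 0 2 : Perm (Fin 4)) 1) by decide),
      τ.edge_relabel_congr (show s((swap 0 1 * swap 0 3 : Perm (Fin 4)) 0,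
        (swap 0 1 * swap 0 3 : Perm (Fin 4)) 1) = s((swap 1 3 : Perm (Fin 4)) 0,
          (swap 1 3 : Perm (Fin 4)) 1) by decide)]
    rw [sign_swap (by decide)]
    push_cast
    ring
  have gen02 : ∀ X : Frame ι, τ.turn w (relabel (swap 0 2 * swap 1 3) X) = τ.turn w X := by
    intro X
    simp only [turn, sgn_relabel, relabel_relabel,
      τ.edge_relabel_congr (show s((swap 0 2 * swap 1 3 * swap 1 3 : Perm (Fin 4)) 0,
        (swap 0 2 * swap 1 3 * swap 1 3 : Perm (Fin 4)) 1) = s((swap 0 2 : Perm (Fin 4)) 0,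
          (swap 0 2 : Perm (Fin 4)) 1) by decide),
      τ.edge_relabel_congr (show s((swap 0 2 * swap 1 3 * swap 0 2 : Perm (Fin 4)) 0,
        (swap 0 2 * swap 1 3 * swap 0 2 : Perm (Fin 4)) 1) = s((swap 1 3 : Perm (Fin 4)) 0,
          (swap 1 3 : Perm (Fin 4)) 1) by decide),
      τ.edge_relabel_congr (show s((swap 0 2 * swap 1 3 * swap 1 2 : Perm (Fin 4)) 0,
        (swap 0 2 * swap 1 3 * swap 1 2 : Perm (Fin 4)) 1) = s((swap 1 2 : Perm (Fin 4)) 0,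
          (swap 1 2 : Perm (Fin 4)) 1) by decide),
      τ.edge_relabel_congr (show s((swap 0 2 * swap 1 3 * swap 0 3 : Perm (Fin 4)) 0,
        (swap 0 2 * swap 1 3 * swap 0 3 : Perm (Fin 4)) 1) = s((swap 0 3 : Perm (Fin 4)) 0,
          (swap 0 3 : Perm (Fin 4)) 1) by decide)]
    have : sign (swap 0 2 * swap 1 3 : Perm (Fin 4)) = 1 := by decide
    rw [this, mul_one]
    ring
  have gen02' : ∀ X : Frame ι,
      τ.turn w (relabel (swap 1 3) (relabel (swap 0 2) X)) = τ.turn w X := by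
    intro X
    rw [relabel_relabel, gen02]
  have gen23 : ∀ X : Frame ι, τ.turn w (relabel (swap 2 3) X) = τ.turn w X := by
    intro X
    rw [turn_eq_halfTurn, turn_eq_halfTurn, mirror, mirror, relabel_relabel, swap_mul_self,
      relabel_one, add_comm]
  have key : ∀ π : Perm (Fin 4), oppPair (π 0) (π 1) = 0 →
      π = 1 ∨ π = swap 0 1 ∨ π = swap 2 3 ∨ π = swap 0 1 * swap 2 3 ∨
      π = swap 0 2 * swap 1 3 ∨ π = (swap 0 2 * swap 1 3) * swap 0 1 ∨
      π = (swap 0 2 * swap 1 3) * swap 2 3 ∨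
      π = (swap 0 2 * swap 1 3) * (swap 0 1 * swap 2 3) := by decide
  rcases key π h with rfl | rfl | rfl | rfl | rfl | rfl | rfl | rfl <;>
    simp only [← relabel_relabel, gen01, gen02', gen23, relabel_one]

/-- The infinitesimal deformation of angle structures that is given by weights of the edges. -/
noncomputable def deformation (w : τ.Edge → ℝ) : AngleVector ι :=
  fun i q => τ.turn w (i, stdPerm q)

theorem deformation_oppPair (w : τ.Edge → ℝ) (X : Frame ι) :
    τ.deformation w X.1 (oppPair (X.2 0) (X.2 1)) = τ.turn w X := by
  set P := stdPerm (oppPair (X.2 0) (X.2 1)) with hP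
  have e : X = relabel (P⁻¹ * X.2) (X.1, P) := by simp [relabel]
  have h : oppPair ((P⁻¹ * X.2) 0) ((P⁻¹ * X.2) 1) = 0 := by
    have h1 := oppPair_stdPerm (oppPair (X.2 0) (X.2 1))
    rw [← hP] at h1
    have h2 := (oppPair_perm_iff P (a := (P⁻¹ * X.2) 0) (b := (P⁻¹ * X.2) 1) (c := 0) (d := 1)
      ((P⁻¹ * X.2).injective.ne (by decide)) (by decide)).1 (by simpa using h1.symm)
    rw [h2]
    decide
  rw [deformation, ← hP]
  conv_rhs => rw [e]
  rw [turn_relabel τ w h]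

/-- The rate is, up to the sign of the numbering, the difference of the total weights of the other
two opposite pairs; the three differences telescope cyclically. -/
theorem turn_add_turn (w : τ.Edge → ℝ) (X : Frame ι) :
    τ.turn w X + τ.turn w (relabel (swap 1 2) X) + τ.turn w (relabel (swap 1 3) X) = 0 := by
  simp only [turn, sgn_relabel, relabel_relabel]
  have e1 : relabel (swap 1 2 * swap 1 2) X = X := by rw [swap_mul_self, relabel_one]
  have e2 : relabel (swap 1 3 * swap 1 3) X = X := by rw [swap_mul_self, relabel_one]
  rw [e1, e2,
    τ.edge_relabel_congr (show s((swap 1 2 * swap 1 3 : Perm (Fin 4)) 0,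
        (swap 1 2 * swap 1 3 : Perm (Fin 4)) 1) = s((swap 1 3 : Perm (Fin 4)) 0,
          (swap 1 3 : Perm (Fin 4)) 1) by decide),
    τ.edge_relabel_congr (show s((swap 1 2 * swap 0 2 : Perm (Fin 4)) 0,
        (swap 1 2 * swap 0 2 : Perm (Fin 4)) 1) = s((swap 0 2 : Perm (Fin 4)) 0,
          (swap 0 2 : Perm (Fin 4)) 1) by decide),
    τ.edge_relabel_congr (show s((swap 1 2 * swap 0 3 : Perm (Fin 4)) 0,
        (swap 1 2 * swap 0 3 : Perm (Fin 4)) 1) = s((swap 0 2 * swap 1 3 : Perm (Fin 4)) 0,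
          (swap 0 2 * swap 1 3 : Perm (Fin 4)) 1) by decide),
    τ.edge_relabel_congr (show s((swap 1 3 * swap 0 2 : Perm (Fin 4)) 0,
        (swap 1 3 * swap 0 2 : Perm (Fin 4)) 1) = s((swap 0 2 * swap 1 3 : Perm (Fin 4)) 0,
          (swap 0 2 * swap 1 3 : Perm (Fin 4)) 1) by decide),
    τ.edge_relabel_congr (show s((swap 1 3 * swap 1 2 : Perm (Fin 4)) 0,
        (swap 1 3 * swap 1 2 : Perm (Fin 4)) 1) = s((swap 1 2 : Perm (Fin 4)) 0,
          (swap 1 2 : Perm (Fin 4)) 1) by decide),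
    τ.edge_relabel_congr (show s((swap 1 3 * swap 0 3 : Perm (Fin 4)) 0,
        (swap 1 3 * swap 0 3 : Perm (Fin 4)) 1) = s((swap 0 3 : Perm (Fin 4)) 0,
          (swap 0 3 : Perm (Fin 4)) 1) by decide)]
  rw [sign_swap (by decide), sign_swap (by decide)]
  push_cast
  ring

theorem sum_fin_three_oppPair (f : Fin 3 → ℝ) (P : Perm (Fin 4)) :
    ∑ q, f q = f (oppPair (P 0) (P 1)) + f (oppPair (P 0) (P 2)) + f (oppPair (P 0) (P 3)) := by
  have h1 : oppPair (P 0) (P 1) ≠ oppPair (P 0) (P 2) :=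
    (oppPair_perm_iff P (by decide) (by decide)).not.2 (by decide)
  have h2 : oppPair (P 0) (P 1) ≠ oppPair (P 0) (P 3) :=
    (oppPair_perm_iff P (by decide) (by decide)).not.2 (by decide)
  have h3 : oppPair (P 0) (P 2) ≠ oppPair (P 0) (P 3) :=
    (oppPair_perm_iff P (by decide) (by decide)).not.2 (by decide)
  have key : ∀ a b c : Fin 3, a ≠ b → a ≠ c → b ≠ c → (Finset.univ : Finset (Fin 3)) = {a, b, c} := by
    decide
  rw [key _ _ _ h1 h2 h3, Finset.sum_insert (by simp [h1, h2]), Finset.sum_pair h3]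
  ring

theorem sum_deformation (w : τ.Edge → ℝ) (i : ι) : ∑ q, τ.deformation w i q = 0 := by
  rw [sum_fin_three_oppPair _ 1, ← τ.turn_add_turn w (i, 1), ← deformation_oppPair,
    ← deformation_oppPair, ← deformation_oppPair]
  rfl

-- Each tetrahedron edge carries four frames (two tips, two signs), so the sum over frames is four
-- times the desired one. Over frames, crossing a face is an involution that negates the half turns,
-- so they cancel; the mirrored half turns are a rearrangement of the same sum.
open Classical in
theorem sum_deformation_edge [Fintype ι] (w : τ.Edge → ℝ) (e : τ.Edge) :
    ∑ x : TetEdge ι with τ.edgeOf x = e, τ.deformation w x.1 (pairOf x.2.1) = 0 := by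
  have hcross : ∑ X : Frame ι with τ.edge X = e, τ.halfTurn w X = 0 := by
    have h : ∑ X : Frame ι with τ.edge X = e, τ.halfTurn w X
        = ∑ X : Frame ι with τ.edge X = e, τ.halfTurn w (τ.cross 2 X) :=
      Finset.sum_nbij' (τ.cross 2) (τ.cross 2)
        (by simp +contextual [τ.edge_cross (show (2 : Fin 4) ≠ 0 by decide) (by decide)])
        (by simp +contextual [τ.edge_cross (show (2 : Fin 4) ≠ 0 by decide) (by decide)])
        (by simp) (by simp) (by simp)
    simp only [halfTurn_cross, Finset.sum_neg_distrib] at h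
    linarith
  have hmirror : ∑ X : Frame ι with τ.edge X = e, τ.halfTurn w (mirror X) = 0 := by
    rw [← hcross]
    exact Finset.sum_nbij' mirror mirror (by simp +contextual) (by simp +contextual)
      (by simp [relabel_relabel]) (by simp [relabel_relabel]) (by simp)
  have hturn : ∑ X : Frame ι with τ.edge X = e, τ.turn w X = 0 := by
    simp only [turn_eq_halfTurn, Finset.sum_add_distrib, hcross, hmirror, add_zero]
  rw [← Finset.sum_fiberwise_of_maps_to (g := Frame.tetEdge)
    (t := Finset.univ.filter fun x : TetEdge ι => τ.edgeOf x = e)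
    (fun X hX => by
      rw [Finset.mem_filter] at hX ⊢
      exact ⟨Finset.mem_univ _, hX.2⟩)] at hturn
  have hfib : ∀ x ∈ Finset.univ.filter fun x : TetEdge ι => τ.edgeOf x = e,
      ∑ X ∈ (Finset.univ.filter fun X : Frame ι => τ.edge X = e) with X.tetEdge = x, τ.turn w X
        = 4 * τ.deformation w x.1 (pairOf x.2.1) := by
    intro x hx
    have hx' : τ.edgeOf x = e := by simpa using hx
    have hval : ∀ X ∈ (Finset.univ.filter fun X : Frame ι => τ.edge X = e).filter
        (fun X => X.tetEdge = x), τ.turn w X = τ.deformation w x.1 (pairOf x.2.1) := by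
      intro X hX
      obtain ⟨-, rfl⟩ := Finset.mem_filter.1 hX
      rw [← deformation_oppPair]
      rfl
    rw [Finset.sum_congr rfl hval, Finset.sum_const, nsmul_eq_mul]
    congr 1
    have hc : ∀ s : Sym2 (Fin 4), ¬ s.IsDiag →
        (Finset.univ.filter fun P : Perm (Fin 4) => s(P 0, P 1) = s).card = 4 := by decide
    have hset : (Finset.univ.filter fun X : Frame ι => τ.edge X = e).filter
        (fun X => X.tetEdge = x) = (Finset.univ.filter fun P : Perm (Fin 4) =>
          s(P 0, P 1) = x.2.1).map ⟨Prod.mk x.1, Prod.mk_right_injective x.1⟩ := by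
      ext X
      simp only [Finset.mem_filter, Finset.mem_univ, true_and, Finset.mem_map]
      constructor
      · rintro ⟨-, rfl⟩
        exact ⟨X.2, rfl, rfl⟩
      · rintro ⟨P, hP, rfl⟩
        have : Frame.tetEdge (x.1, P) = x := Prod.ext rfl (Subtype.ext hP)
        exact ⟨(congrArg τ.edgeOf this).trans hx', this⟩
    rw [hset, Finset.card_map]
    exact_mod_cast hc _ x.2.2
  rw [Finset.sum_congr rfl hfib, ← Finset.mul_sum] at hturn
  linarith

end OrientedGluing

/-- The angle at a frame. -/
def Frame.angle {ι : Type*} (α : AngleVector ι) (X : Frame ι) : ℝ :=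
  α X.1 (oppPair (X.2 0) (X.2 1))

theorem Frame.angle_relabel_congr {ι : Type*} (α : AngleVector ι) {π ρ : Perm (Fin 4)}
    (h : oppPair (π 0) (π 1) = oppPair (ρ 0) (ρ 1)) (X : Frame ι) :
    (relabel π X).angle α = (relabel ρ X).angle α := by
  simp only [angle, relabel, mul_apply]
  rw [(oppPair_perm_iff X.2 (π.injective.ne (by decide)) (ρ.injective.ne (by decide))).2 h]

/-- The angle at a frame is `π`. -/
def Frame.Flat {ι : Type*} (α : AngleVector ι) (X : Frame ι) : Prop := X.angle α = Real.pi

/-- The first vertex of the tetrahedron of a frame is joined to the last one by an edge of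
angle `π`. -/
def Frame.Valid {ι : Type*} (α : AngleVector ι) (X : Frame ι) : Prop :=
  (relabel (swap 1 3) X).angle α = Real.pi

/-! ### Frames at flat edges and frames numbered by their flat edges. -/

namespace Frame

variable {ι : Type*} {α : AngleVector ι} {X : Frame ι}

theorem flat_relabel {π : Perm (Fin 4)} (h : oppPair (π 0) (π 1) = 0) :
    (relabel π X).Flat α ↔ X.Flat α := by
  have := X.angle_relabel_congr α (π := π) (ρ := 1) (by rw [h]; decide)
  rw [Flat, this, relabel_one, Flat]

theorem valid_relabel {π : Perm (Fin 4)} (h : oppPair (π 0) (π 3) = 2) :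
    (relabel π X).Valid α ↔ X.Valid α := by
  rw [Valid, relabel_relabel, Valid,
    X.angle_relabel_congr α (π := π * swap 1 3) (ρ := swap 1 3)]
  have : oppPair ((π * swap 1 3 : Perm (Fin 4)) 0) ((π * swap 1 3 : Perm (Fin 4)) 1)
      = oppPair (π 0) (π 3) := by
    simp [swap_apply_of_ne_of_ne]
  rw [this, h]
  decide

@[simp] theorem flat_flip : (flip X).Flat α ↔ X.Flat α := flat_relabel (by decide)

@[simp] theorem valid_flip : (flip X).Valid α ↔ X.Valid α := valid_relabel (by decide)

theorem valid_swap : (relabel (swap 1 2) X).Valid α ↔ X.Valid α := valid_relabel (by decide)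

theorem valid_relabel_iff_flat {π : Perm (Fin 4)} (h : oppPair (π 0) (π 3) = 0) :
    (relabel π X).Valid α ↔ X.Flat α := by
  rw [Valid, relabel_relabel, Flat,
    X.angle_relabel_congr α (π := π * swap 1 3) (ρ := 1), relabel_one]
  have : oppPair ((π * swap 1 3 : Perm (Fin 4)) 0) ((π * swap 1 3 : Perm (Fin 4)) 1)
      = oppPair (π 0) (π 3) := by
    simp [swap_apply_of_ne_of_ne]
  rw [this, h]
  decide

theorem sgn_mirror (X : Frame ι) : (mirror X).sgn = - X.sgn := by
  rw [sgn_relabel, sign_swap (by decide), mul_neg_one]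

theorem sgn_flip (X : Frame ι) : (flip X).sgn = X.sgn := by
  rw [sgn_relabel, show sign (swap 0 1 * swap 2 3 : Perm (Fin 4)) = 1 by decide, mul_one]

end Frame

namespace OrientedGluing

theorem edge_swap_rot {ι : Type*} (τ : OrientedGluing ι) (X : Frame ι) :
    τ.edge (relabel (swap 1 2) (τ.rot X)) = τ.edge (relabel (swap 1 3) X) := by
  rw [τ.rot_apply, relabel_relabel, τ.edge_relabel_cross (by decide) (by decide)]
  exact τ.edge_relabel_congr (by decide) X

end OrientedGluing

/-! ### Colours of edges in a veering structure. -/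

namespace IdealTriangulation

variable {ι : Type*} [Fintype ι] {τ : IdealTriangulation ι} {α : AngleVector ι}

theorem IsTautAngleStructure.angle_add (h : τ.IsTautAngleStructure α) (X : Frame ι) :
    X.angle α + (relabel (swap 1 2) X).angle α + (relabel (swap 1 3) X).angle α = Real.pi := by
  rw [← h.tetrahedron X.1, OrientedGluing.sum_fin_three_oppPair _ X.2]
  simp [angle, relabel, swap_apply_of_ne_of_ne]

theorem IsTautAngleStructure.angle_eq (h : τ.IsTautAngleStructure α) (X : Frame ι) :
    X.angle α = 0 ∨ X.angle α = Real.pi := h.taut _ _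

theorem IsTautAngleStructure.not_flat_of_valid (h : τ.IsTautAngleStructure α) {X : Frame ι}
    (hX : X.Valid α) : ¬ X.Flat α := by
  intro hF
  have h1 := h.angle_add X
  rw [Valid] at hX
  rw [Flat] at hF
  have := Real.pi_pos
  rcases h.angle_eq (relabel (swap 1 2) X) with h2 | h2 <;> linarith

theorem IsTautAngleStructure.angle_eq_zero (h : τ.IsTautAngleStructure α) {X : Frame ι}
    (hX : ¬ X.Flat α) : X.angle α = 0 :=
  (h.angle_eq X).resolve_right hX

theorem IsTautAngleStructure.valid_or (h : τ.IsTautAngleStructure α) {X : Frame ι}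
    (hX : ¬ X.Flat α) : X.Valid α ∨ (mirror X).Valid α := by
  have h1 := h.angle_add X
  rw [h.angle_eq_zero hX] at h1
  have e : (mirror X).Valid α ↔ (relabel (swap 1 2) X).angle α = Real.pi := by
    rw [Valid, relabel_relabel, X.angle_relabel_congr α (ρ := swap 1 2) (by decide)]
  rw [e, Valid]
  have := Real.pi_pos
  rcases h.angle_eq (relabel (swap 1 3) X) with h2 | h2
  · right
    linarith
  · left
    exact h2

/-- In a valid frame the π-corner of the cusp triangle is the one numbered 3. The sign of the frame
tells on which side of the corner numbered 1 it lies, and the veering condition fixes that side at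
each vertex. -/
theorem IsVeering.sgn_eq_of_cuspVertexOf_eq (h : τ.IsVeering α) {X Y : Frame ι}
    (hX : X.Valid α) (hY : Y.Valid α)
    (hv : τ.cuspVertexOf X.corner = τ.cuspVertexOf Y.corner) : X.sgn = Y.sgn := by
  have hnext : ∀ Z : Frame ι, Z.sgn = 1 → IsNextCCW (Z.2 0) (Z.2 1) (Z.2 2) :=
    fun Z hZ => ⟨Z.2, hZ, rfl, rfl, rfl⟩
  have hnext' : ∀ Z : Frame ι, Z.sgn = -1 → IsNextCCW (Z.2 0) (Z.2 2) (Z.2 1) :=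
    fun Z hZ => ⟨Z.2 * swap 1 2, by
      rw [sgn] at hZ
      rw [Perm.sign_mul, hZ, sign_swap (by decide)]; rfl,
      by simp [swap_apply_of_ne_of_ne], by simp, by simp⟩
  have hzero : ∀ Z : Frame ι, Z.Valid α → α Z.1 (oppPair (Z.2 0) (Z.2 1)) = 0 ∧
      α Z.1 (oppPair (Z.2 0) (Z.2 2)) ≠ Real.pi := by
    intro Z hZ
    refine ⟨h.angle_eq_zero (h.not_flat_of_valid hZ), ?_⟩
    have h2 := h.not_flat_of_valid ((valid_swap).2 hZ)
    simpa [Flat, angle, relabel, swap_apply_of_ne_of_ne] using h2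
  rcases h.veering (τ.cuspVertexOf X.corner) with hb | ha
  · have key : ∀ Z : Frame ι, Z.Valid α → τ.cuspVertexOf Z.corner = τ.cuspVertexOf X.corner →
        Z.sgn = 1 := by
      intro Z hZ hZv
      rcases Int.units_eq_one_or Z.sgn with hs | hs
      · exact hs
      · exact absurd (hb Z.1 (Z.2 0) (Z.2 1) (Z.2 2) (by simp) hZv (hzero Z hZ).1 (hnext' Z hs))
          (hzero Z hZ).2
    rw [key X hX rfl, key Y hY hv.symm]
  · have key : ∀ Z : Frame ι, Z.Valid α → τ.cuspVertexOf Z.corner = τ.cuspVertexOf X.corner →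
        Z.sgn = -1 := by
      intro Z hZ hZv
      rcases Int.units_eq_one_or Z.sgn with hs | hs
      · exact absurd (ha Z.1 (Z.2 0) (Z.2 1) (Z.2 2) (by simp) hZv (hzero Z hZ).1 (hnext Z hs))
          (hzero Z hZ).2
      · exact hs
    rw [key X hX rfl, key Y hY hv.symm]

/-- The veering condition speaks of one end of an edge at a time; `flip` passes to the other end and
preserves both validity and sign. -/
theorem IsVeering.sgn_eq_of_edge_eq (h : τ.IsVeering α) {X Y : Frame ι}
    (hX : X.Valid α) (hY : Y.Valid α) (he : τ.edge X = τ.edge Y) : X.sgn = Y.sgn := by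
  by_contra hne
  have hs : X.sgn = (mirror Y).sgn := by
    rw [sgn_mirror]
    exact Int.units_ne_iff_eq_neg.1 hne
  rcases τ.sameCycle_of_edge_eq (by rw [he, τ.edge_mirror]) hs with hc | hc
  · have := τ.cuspVertexOf_sameCycle hc
    rw [corner_mirror] at this
    exact hne (h.sgn_eq_of_cuspVertexOf_eq hX hY this)
  · have := τ.cuspVertexOf_sameCycle hc
    have e : flip (mirror Y) = mirror (flip Y) := by
      simp only [relabel_relabel]
      congr 1
      decide
    rw [e, corner_mirror] at this
    exact hne ((h.sgn_eq_of_cuspVertexOf_eq hX (valid_flip.2 hY) this).trans (sgn_flip Y))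

open Classical in
/-- The colour of an edge in a veering triangulation. -/
noncomputable def colour (τ : IdealTriangulation ι) (α : AngleVector ι) (e : τ.Edge) : ℤˣ :=
  if ∃ X : Frame ι, X.Valid α ∧ τ.edge X = e ∧ X.sgn = 1 then 1 else -1

theorem IsVeering.colour_edge (h : τ.IsVeering α) {X : Frame ι} (hX : X.Valid α) :
    τ.colour α (τ.edge X) = X.sgn := by
  unfold colour
  split_ifs with hc
  · obtain ⟨Y, hY, he, hs⟩ := hc
    rw [← hs]
    exact h.sgn_eq_of_edge_eq hY hX he
  · rcases Int.units_eq_one_or X.sgn with hs | hs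
    · exact absurd ⟨X, hX, rfl, hs⟩ hc
    · exact hs.symm

/-- The frames whose sign is the colour of their edge are rotated among themselves. -/
theorem IsVeering.flat_or_valid (h : τ.IsVeering α) {X : Frame ι}
    (hX : τ.colour α (τ.edge X) = X.sgn) (hF : ¬ X.Flat α) : X.Valid α := by
  rcases h.valid_or hF with hv | hv
  · exact hv
  · have := h.colour_edge hv
    rw [τ.edge_mirror, hX, sgn_mirror] at this
    exact absurd this (by rcases Int.units_eq_one_or X.sgn with hs | hs <;> rw [hs] <;> decide)

theorem IsVeering.colour_swap (h : τ.IsVeering α) {X : Frame ι} (hX : X.Valid α) :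
    τ.colour α (τ.edge (relabel (swap 1 2) X)) = - X.sgn := by
  rw [h.colour_edge ((valid_swap).2 hX), sgn_relabel,
    sign_swap (by decide), mul_neg_one]

/-- The edge 03 lies in the face shared with the next tetrahedron. If that tetrahedron has π at 01,
its copy of 03 is thin, and a valid numbering there reveals the colour. -/
theorem IsVeering.colour_of_flat_rot (h : τ.IsVeering α) {X : Frame ι} (hX : (τ.rot X).Flat α) :
    τ.colour α (τ.edge (relabel (swap 1 3) X)) = X.sgn := by
  have hv : (relabel (swap 1 2 * swap 2 3 : Perm (Fin 4)) (τ.rot X)).Valid α :=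
    (valid_relabel_iff_flat (by decide)).2 hX
  have e : τ.edge (relabel (swap 1 2 * swap 2 3 : Perm (Fin 4)) (τ.rot X))
      = τ.edge (relabel (swap 1 3) X) := by
    rw [← τ.edge_swap_rot]
    exact τ.edge_relabel_congr (by decide) _
  rw [← e, h.colour_edge hv, sgn_relabel, τ.sgn_rot,
    show sign (swap 1 2 * swap 2 3 : Perm (Fin 4)) = 1 by decide, mul_one]

theorem IsVeering.colour_of_valid_rot (h : τ.IsVeering α) {X : Frame ι} (hX : (τ.rot X).Valid α) :
    τ.colour α (τ.edge (relabel (swap 1 3) X)) = - X.sgn := by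
  rw [← τ.edge_swap_rot, h.colour_swap hX, τ.sgn_rot]

theorem units_ne_neg (s : ℤˣ) : s ≠ - s := by
  rcases Int.units_eq_one_or s with rfl | rfl <;> decide

/-- Two adjacent π-angles would give an edge of the face between them opposite colours when it is
read from the two sides. -/
theorem IsVeering.not_flat_rot (h : τ.IsVeering α) {X : Frame ι} (hX : X.Flat α) :
    ¬ (τ.rot X).Flat α := by
  intro hr
  have h1 := h.colour_of_flat_rot hr
  have hv : (relabel (swap 1 3) X).Valid α :=
    (valid_relabel_iff_flat (by decide)).2 hX
  rw [h.colour_edge hv, sgn_relabel, sign_swap (by decide), mul_neg_one] at h1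
  exact units_ne_neg _ h1.symm

/-- Whether the fan continues is decided by the colour of one π-edge: the next frame is flat or
valid, and these two cases force opposite colours on that edge. -/
theorem IsVeering.valid_rot_iff (h : τ.IsVeering α) {X : Frame ι} (hX : X.Valid α) :
    (τ.rot X).Valid α ↔ τ.colour α (τ.edge (relabel (swap 1 3) X)) = - X.sgn := by
  refine ⟨h.colour_of_valid_rot, fun hc => h.flat_or_valid ?_ fun hF => ?_⟩
  · rw [τ.edge_rot, τ.sgn_rot, h.colour_edge hX]
  · rw [h.colour_of_flat_rot hF] at hc
    exact units_ne_neg _ hc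

theorem IsVeering.valid_rot_inv_iff (h : τ.IsVeering α) {X : Frame ι} (hX : X.Valid α) :
    (τ.rot⁻¹ X).Valid α ↔ τ.colour α (τ.edge (relabel (swap 0 2) X)) = - X.sgn := by
  have h1 := h.valid_rot_iff (valid_flip.2 hX)
  rw [τ.rot_flip, valid_flip, sgn_flip, relabel_relabel,
    τ.edge_relabel_congr (ρ := swap 0 2) (by decide)] at h1
  exact h1

end IdealTriangulation

/-! ### Counting flat angles, and lengths of fans. -/

namespace IdealTriangulation

variable {ι : Type*} [Fintype ι] {τ : IdealTriangulation ι} {α : AngleVector ι}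

open Classical in
theorem IsTautAngleStructure.card_flat (h : τ.IsTautAngleStructure α) (e : τ.Edge) :
    (Finset.univ.filter fun x : TetEdge ι =>
      τ.edgeOf x = e ∧ α x.1 (pairOf x.2.1) = Real.pi).card = 2 := by
  have h1 := h.edge e
  have h2 : ∀ x : TetEdge ι, α x.1 (pairOf x.2.1)
      = if α x.1 (pairOf x.2.1) = Real.pi then Real.pi else 0 := by
    intro x
    rcases h.taut x.1 (pairOf x.2.1) with h0 | h0
    · rw [h0, if_neg Real.pi_ne_zero.symm]
    · rw [if_pos h0, h0]
  rw [Finset.sum_congr rfl fun x _ => h2 x, ← Finset.sum_filter, Finset.filter_filter,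
    Finset.sum_const, nsmul_eq_mul] at h1
  exact_mod_cast mul_right_cancel₀ Real.pi_ne_zero h1

omit [Fintype ι] in
theorem exists_frame (x : TetEdge ι) (s : ℤˣ) : ∃ X : Frame ι, X.tetEdge = x ∧ X.sgn = s := by
  obtain ⟨X, hX⟩ := exists_tetEdge x
  by_cases hs : X.sgn = s
  · exact ⟨X, hX, hs⟩
  · refine ⟨mirror X, by rw [tetEdge_relabel _ (by decide), hX], ?_⟩
    rw [sgn_mirror]
    exact (Int.units_ne_iff_eq_neg.1 (Ne.symm hs)).symm

theorem IsTautAngleStructure.exists_flat (h : τ.IsTautAngleStructure α) (e : τ.Edge) (s : ℤˣ) :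
    ∃ Z : Frame ι, Z.Flat α ∧ τ.edge Z = e ∧ Z.sgn = s := by
  classical
  have h1 : 0 < (Finset.univ.filter fun x : TetEdge ι =>
      τ.edgeOf x = e ∧ α x.1 (pairOf x.2.1) = Real.pi).card := by
    rw [h.card_flat e]
    decide
  obtain ⟨x, hx⟩ := Finset.card_pos.1 h1
  obtain ⟨-, hx1, hx2⟩ := Finset.mem_filter.1 hx
  obtain ⟨X, rfl, hs⟩ := exists_frame x s
  exact ⟨X, hx2, hx1, hs⟩

/-- At most two of the tetrahedron edges at an edge have the angle `π`. -/
theorem IsTautAngleStructure.eq_or_eq_of_flat (h : τ.IsTautAngleStructure α) {X Y Z : Frame ι}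
    (hX : X.Flat α) (hY : Y.Flat α) (hZ : Z.Flat α) (hXY : X.tetEdge ≠ Y.tetEdge)
    (eX : τ.edge X = τ.edge Z) (eY : τ.edge Y = τ.edge Z) :
    Z.tetEdge = X.tetEdge ∨ Z.tetEdge = Y.tetEdge := by
  classical
  by_contra hne
  rw [not_or] at hne
  have h1 : ({X.tetEdge, Y.tetEdge, Z.tetEdge} : Finset (TetEdge ι)) ⊆
      Finset.univ.filter fun x : TetEdge ι =>
        τ.edgeOf x = τ.edge Z ∧ α x.1 (pairOf x.2.1) = Real.pi := by
    intro x hx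
    simp only [Finset.mem_insert, Finset.mem_singleton] at hx
    rw [Finset.mem_filter]
    rcases hx with rfl | rfl | rfl
    · exact ⟨Finset.mem_univ _, eX, hX⟩
    · exact ⟨Finset.mem_univ _, eY, hY⟩
    · exact ⟨Finset.mem_univ _, rfl, hZ⟩
  have h2 := Finset.card_le_card h1
  rw [h.card_flat, Finset.card_insert_of_notMem (by simp [hXY, Ne.symm hne.1]),
    Finset.card_pair (Ne.symm hne.2)] at h2
  omega

theorem exists_rot_pow_eq {X Y : Frame ι} (h : τ.rot.SameCycle X Y) :
    ∃ k : ℕ, (τ.rot ^ k) X = Y := by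
  obtain ⟨k, -, hk⟩ := h.exists_pow_eq'
  exact ⟨k, hk⟩

/-- There is more than one flat frame on each orbit of the rotation. -/
theorem IsTautAngleStructure.exists_flat_ne (h : τ.IsTautAngleStructure α) (Y : Frame ι) :
    ∃ k : ℕ, ((τ.rot ^ k) Y).Flat α ∧ (τ.rot ^ k) Y ≠ Y := by
  classical
  have h1 : 1 < (Finset.univ.filter fun x : TetEdge ι =>
      τ.edgeOf x = τ.edge Y ∧ α x.1 (pairOf x.2.1) = Real.pi).card := by
    rw [h.card_flat]
    decide
  obtain ⟨x, hx, hne⟩ := Finset.exists_mem_ne h1 Y.tetEdge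
  obtain ⟨-, hx1, hx2⟩ := Finset.mem_filter.1 hx
  obtain ⟨Z, rfl, hs⟩ := exists_frame x Y.sgn
  rcases τ.sameCycle_of_edge_eq (show τ.edge Y = τ.edge Z from hx1.symm) hs.symm with hc | hc
  · obtain ⟨k, hk⟩ := exists_rot_pow_eq hc
    refine ⟨k, by rw [hk]; exact hx2, fun he => hne ?_⟩
    rw [← hk, he]
  · obtain ⟨k, hk⟩ := exists_rot_pow_eq hc
    refine ⟨k, by rw [hk, flat_flip]; exact hx2, fun he => hne ?_⟩
    rw [← he, hk, tetEdge_relabel _ (by decide)]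

omit [Fintype ι] in
theorem edge_rot_pow (n : ℕ) (X : Frame ι) : τ.edge ((τ.rot ^ n) X) = τ.edge X := by
  induction n with
  | zero => rfl
  | succ n ih => rw [pow_succ', mul_apply, τ.edge_rot, ih]

omit [Fintype ι] in
theorem sgn_rot_pow (n : ℕ) (X : Frame ι) : ((τ.rot ^ n) X).sgn = X.sgn := by
  induction n with
  | zero => rfl
  | succ n ih => rw [pow_succ', mul_apply, τ.sgn_rot, ih]

/-- The rotation orbit meets a flat frame, up to changing the tip. Hence the infimum in `ahead` is
attained and is not the default value for the empty set. -/
theorem IsTautAngleStructure.exists_not_valid (h : τ.IsTautAngleStructure α) (X : Frame ι) :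
    ∃ n : ℕ, ¬ ((τ.rot ^ (n + 1)) X).Valid α := by
  by_contra! hall
  obtain ⟨Z, hZ, he, hs⟩ := h.exists_flat (τ.edge (τ.rot X)) (τ.rot X).sgn
  have key : ∀ W : Frame ι, W.Flat α → ¬ τ.rot.SameCycle (τ.rot X) W := by
    intro W hW hc
    obtain ⟨k, hk⟩ := exists_rot_pow_eq hc
    refine h.not_flat_of_valid (hall k) ?_
    rw [pow_succ, mul_apply, hk]
    exact hW
  rcases τ.sameCycle_of_edge_eq he.symm hs.symm with hc | hc
  · exact key _ hZ hc
  · exact key _ (flat_flip.2 hZ) hc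

/-- The number of frames that follow a given frame in its fan. -/
noncomputable def ahead (τ : IdealTriangulation ι) (α : AngleVector ι) (X : Frame ι) : ℕ :=
  sInf {n : ℕ | ¬ ((τ.rot ^ (n + 1)) X).Valid α}

theorem IsTautAngleStructure.not_valid_ahead (h : τ.IsTautAngleStructure α) (X : Frame ι) :
    ¬ ((τ.rot ^ (τ.ahead α X + 1)) X).Valid α :=
  Nat.sInf_mem (s := {n : ℕ | ¬ ((τ.rot ^ (n + 1)) X).Valid α}) (h.exists_not_valid X)

omit [Fintype ι] in
theorem valid_of_le_ahead {X : Frame ι} (hX : X.Valid α) {k : ℕ} (hk : k ≤ τ.ahead α X) :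
    ((τ.rot ^ k) X).Valid α := by
  cases k with
  | zero => exact hX
  | succ k =>
    have := Nat.notMem_of_lt_sInf (s := {n : ℕ | ¬ ((τ.rot ^ (n + 1)) X).Valid α}) hk
    simpa using this

omit [Fintype ι] in
theorem ahead_eq_zero {X : Frame ι} (hX : ¬ (τ.rot X).Valid α) : τ.ahead α X = 0 :=
  Nat.sInf_eq_zero.2 (Or.inl hX)

theorem IsTautAngleStructure.ahead_eq_succ (h : τ.IsTautAngleStructure α) {X : Frame ι}
    (hX : (τ.rot X).Valid α) : τ.ahead α X = τ.ahead α (τ.rot X) + 1 := by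
  apply le_antisymm
  · apply Nat.sInf_le
    have := h.not_valid_ahead (τ.rot X)
    rwa [← mul_apply, ← pow_succ] at this
  · have h1 : τ.ahead α X ≠ 0 := by
      intro h0
      have := h.not_valid_ahead X
      rw [h0] at this
      exact this (by simpa using hX)
    have h2 : τ.ahead α (τ.rot X) ≤ τ.ahead α X - 1 := by
      apply Nat.sInf_le
      have := h.not_valid_ahead X
      rw [Set.mem_ofPred_eq, ← mul_apply, ← pow_succ]
      rwa [Nat.sub_add_cancel (Nat.one_le_iff_ne_zero.2 h1)]
    omega

/-- The frames of a fan are distinct. -/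
theorem IsTautAngleStructure.rot_pow_injOn (h : τ.IsTautAngleStructure α) {X : Frame ι}
    (hX : X.Valid α) :
    Set.InjOn (fun k : ℕ => (τ.rot ^ k) X) {k | k ≤ τ.ahead α X} := by
  -- A repetition within the fan would make the whole rotation orbit valid.
  have key : ∀ p : ℕ, 0 < p → p ≤ τ.ahead α X → (τ.rot ^ p) X ≠ X := by
    intro p hp hle he
    have hper : ∀ n : ℕ, ((τ.rot ^ n) X).Valid α := by
      intro n
      have h1 : ∀ m : ℕ, (τ.rot ^ (p * m)) X = X := by
        intro m
        induction m with
        | zero => simp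
        | succ m ih => rw [Nat.mul_succ, pow_add, mul_apply, he, ih]
      rw [← Nat.mod_add_div n p, pow_add, mul_apply, h1]
      exact valid_of_le_ahead hX ((Nat.mod_lt n hp).le.trans hle)
    obtain ⟨n, hn⟩ := h.exists_not_valid X
    exact hn (hper _)
  have aux : ∀ a b : ℕ, a < b → b ≤ τ.ahead α X → (τ.rot ^ a) X ≠ (τ.rot ^ b) X := by
    intro a b hab hb he
    refine key (b - a) (by omega) (by omega) ?_
    apply (τ.rot ^ a).injective
    rw [← mul_apply, ← pow_add, he]
    congr 2
    omega
  intro a ha b hb hab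
  rcases lt_trichotomy a b with hlt | rfl | hlt
  · exact absurd hab (aux a b hlt hb)
  · rfl
  · exact absurd hab.symm (aux b a hlt ha)

theorem IsTautAngleStructure.cornerAngle_eq_zero (h : τ.IsTautAngleStructure α) {X : Frame ι}
    (hX : X.Valid α) : cornerAngle α X.corner = 0 :=
  h.angle_eq_zero (h.not_flat_of_valid hX)

theorem fanLength_le_maxFanLength (F : τ.Fan α) : τ.fanLength α F ≤ τ.maxFanLength α := by
  classical
  have : Finite (τ.ThinCorner α) := inferInstanceAs (Finite {x : Corner ι // cornerAngle α x = 0})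
  have : Finite (τ.Fan α) :=
    Finite.of_surjective (τ.fanOf α) (fun F => Quot.inductionOn F fun x => ⟨x, rfl⟩)
  exact le_ciSup (Set.finite_range _).bddAbove F

theorem IsTautAngleStructure.ahead_lt (h : τ.IsTautAngleStructure α) {X : Frame ι}
    (hX : X.Valid α) : τ.ahead α X + 1 ≤ τ.maxFanLength α := by
  classical
  have : Finite (τ.ThinCorner α) := inferInstanceAs (Finite {x : Corner ι // cornerAngle α x = 0})
  let c : Fin (τ.ahead α X + 1) → τ.ThinCorner α := fun k =>
    ⟨((τ.rot ^ (k : ℕ)) X).corner,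
      h.cornerAngle_eq_zero (valid_of_le_ahead hX (Nat.lt_succ_iff.1 k.2))⟩
  have hc : ∀ (k : ℕ) (hk : k < τ.ahead α X + 1),
      τ.fanOf α (c ⟨k, hk⟩) = τ.fanOf α (c ⟨0, by omega⟩) := by
    intro k
    induction k with
    | zero => intro _; rfl
    | succ k ih =>
      intro hk
      rw [← ih (by omega)]
      symm
      apply Quot.sound
      have := τ.cornerStep_rot ((τ.rot ^ k) X)
      rwa [← mul_apply, ← pow_succ'] at this
  refine le_trans ?_ (fanLength_le_maxFanLength (τ.fanOf α (c ⟨0, by omega⟩)))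
  let f : Fin (τ.ahead α X + 1) → {x : τ.ThinCorner α //
      τ.fanOf α x = τ.fanOf α (c ⟨0, by omega⟩)} := fun k => ⟨c k, hc k k.2⟩
  have hf : Function.Injective f := by
    intro a b hab
    have h1 : ((τ.rot ^ (a : ℕ)) X).corner = ((τ.rot ^ (b : ℕ)) X).corner :=
      congrArg (fun x => x.1.1) hab
    rw [corner_eq_iff (by rw [sgn_rot_pow, sgn_rot_pow])] at h1
    exact Fin.ext (h.rot_pow_injOn hX (Nat.lt_succ_iff.1 a.2) (Nat.lt_succ_iff.1 b.2) h1)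
  have := Nat.card_le_card_of_injective f hf
  simpa [fanLength] using this

/-! ### Interior frames of fans, crossing fans and heights. -/

/-- Exchange the two ends, and the two edges of angle `π`, of a frame. -/
abbrev _root_.VeeringTriangulation.Frame.turnOver (X : Frame ι) : Frame ι :=
  relabel (swap 0 3 * swap 1 2) X

/-- The frame lies in the interior of its fan. -/
def Mid (τ : IdealTriangulation ι) (α : AngleVector ι) (X : Frame ι) : Prop :=
  X.Valid α ∧ (τ.rot X).Valid α ∧ (τ.rot⁻¹ X).Valid α

/-- The condition concerns only the colours of the two π-edges, so it transfers to other edges of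
the tetrahedron: it holds at the opposite edge too, and it makes the frames at 02 and 13 alone in
their fans. -/
theorem IsVeering.mid_iff (h : τ.IsVeering α) {X : Frame ι} :
    τ.Mid α X ↔ X.Valid α ∧ τ.colour α (τ.edge (relabel (swap 1 3) X)) = - X.sgn ∧
      τ.colour α (τ.edge (relabel (swap 0 2) X)) = - X.sgn := by
  unfold Mid
  constructor
  · rintro ⟨h1, h2, h3⟩
    exact ⟨h1, (h.valid_rot_iff h1).1 h2, (h.valid_rot_inv_iff h1).1 h3⟩
  · rintro ⟨h1, h2, h3⟩
    exact ⟨h1, (h.valid_rot_iff h1).2 h2, (h.valid_rot_inv_iff h1).2 h3⟩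

theorem IsVeering.mid_turnOver (h : τ.IsVeering α) {X : Frame ι} (hX : τ.Mid α X) :
    τ.Mid α (turnOver X) := by
  rw [h.mid_iff] at hX ⊢
  rw [valid_relabel (by decide), sgn_relabel, relabel_relabel, relabel_relabel,
    show sign (swap 0 3 * swap 1 2 : Perm (Fin 4)) = 1 by decide, mul_one,
    τ.edge_relabel_congr (π := swap 0 3 * swap 1 2 * swap 1 3) (ρ := swap 1 3) (by decide),
    τ.edge_relabel_congr (π := swap 0 3 * swap 1 2 * swap 0 2) (ρ := swap 0 2) (by decide)]
  exact hX

omit [Fintype ι] in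
theorem mid_flip {X : Frame ι} (hX : τ.Mid α X) : τ.Mid α (flip X) := by
  obtain ⟨h1, h2, h3⟩ := hX
  refine ⟨valid_flip.2 h1, ?_, ?_⟩
  · rw [τ.rot_flip, valid_flip]
    exact h3
  · rw [τ.rot_inv_flip, valid_flip]
    exact h2

/-- A frame that is alone in its fan corresponds to a frame in the interior of a fan. -/
theorem IsVeering.alone_of_mid (h : τ.IsVeering α) {Q : Frame ι}
    (hQ : τ.Mid α (relabel (swap 0 3) Q)) :
    Q.Valid α ∧ ¬ (τ.rot Q).Valid α ∧ ¬ (τ.rot⁻¹ Q).Valid α := by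
  rw [h.mid_iff, valid_relabel (by decide), sgn_relabel, relabel_relabel, relabel_relabel,
    sign_swap (by decide), mul_neg_one, neg_neg,
    τ.edge_relabel_congr (π := swap 0 3 * swap 1 3) (ρ := swap 1 3) (by decide),
    τ.edge_relabel_congr (π := swap 0 3 * swap 0 2) (ρ := swap 0 2) (by decide)] at hQ
  obtain ⟨h1, h2, h3⟩ := hQ
  rw [h.valid_rot_iff h1, h.valid_rot_inv_iff h1, h2, h3]
  exact ⟨h1, units_ne_neg _, units_ne_neg _⟩

/-- The sum, over the frames of a fan up to `X`, of the lengths of the remaining parts of the fans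
that cross it. -/
noncomputable def height (τ : IdealTriangulation ι) (α : AngleVector ι) (X : Frame ι) : ℕ :=
  ∑ k ∈ Finset.range (τ.ahead α (flip X)), τ.ahead α (turnOver ((τ.rot⁻¹ ^ k) X))

omit [Fintype ι] in
theorem height_eq_zero {X : Frame ι} (hX : ¬ (τ.rot⁻¹ X).Valid α) : τ.height α X = 0 := by
  rw [height, ahead_eq_zero, Finset.sum_range_zero]
  rwa [τ.rot_flip, valid_flip]

/-- As `flip` reverses rotation, `ahead` of the flipped frame counts the frames preceding `X`. The
range in `height` therefore omits the first frame of the fan, whose height is 0. -/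
theorem IsTautAngleStructure.height_eq_add (h : τ.IsTautAngleStructure α) {X : Frame ι}
    (hX : (τ.rot⁻¹ X).Valid α) :
    τ.height α X = τ.ahead α (turnOver X) + τ.height α (τ.rot⁻¹ X) := by
  have h1 : (τ.rot (flip X)).Valid α := by rwa [τ.rot_flip, valid_flip]
  rw [height, h.ahead_eq_succ h1, Finset.sum_range_succ', τ.rot_flip, add_comm, height]
  congr 1

theorem IsTautAngleStructure.height_le (h : τ.IsTautAngleStructure α) {X : Frame ι}
    (hX : X.Valid α) : τ.height α X ≤ τ.maxFanLength α ^ 2 := by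
  have h1 : ∀ k ∈ Finset.range (τ.ahead α (flip X)),
      τ.ahead α (turnOver ((τ.rot⁻¹ ^ k) X)) ≤ τ.maxFanLength α := by
    intro k hk
    have hv := valid_of_le_ahead (τ := τ) (valid_flip.2 hX) (Finset.mem_range.1 hk).le
    rw [τ.rot_pow_flip, valid_flip] at hv
    exact (Nat.le_succ _).trans (h.ahead_lt ((valid_relabel (by decide)).2 hv))
  have h2 := Finset.sum_le_card_nsmul _ _ _ h1
  rw [Finset.card_range, smul_eq_mul] at h2
  refine h2.trans ?_
  rw [sq]
  exact Nat.mul_le_mul_right _ ((Nat.le_succ _).trans (h.ahead_lt (valid_flip.2 hX)))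

open Classical in
/-- The height of a frame in the interior of a fan, and `0` for the other frames. -/
noncomputable def midHeight (τ : IdealTriangulation ι) (α : AngleVector ι) (X : Frame ι) : ℕ :=
  if τ.Mid α X then τ.height α X else 0

-- A first frame of a fan has height 0 anyway, so setting non-interior frames to 0 changes the value
-- only at the last one.
omit [Fintype ι] in
theorem midHeight_eq_height {X : Frame ι} (hX : X.Valid α) (hX' : (τ.rot X).Valid α) :
    τ.midHeight α X = τ.height α X := by
  unfold midHeight
  split_ifs with hm
  · rfl
  · rw [height_eq_zero]
    exact fun h3 => hm ⟨hX, hX', h3⟩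

omit [Fintype ι] in
theorem midHeight_of_not_mid {X : Frame ι} (hX : ¬ τ.Mid α X) : τ.midHeight α X = 0 :=
  if_neg hX

theorem IsTautAngleStructure.midHeight_le (h : τ.IsTautAngleStructure α) (X : Frame ι) :
    τ.midHeight α X ≤ τ.maxFanLength α ^ 2 := by
  unfold midHeight
  split_ifs with hm
  · exact h.height_le hm.1
  · exact Nat.zero_le _

omit [Fintype ι] in
theorem turnOver_turnOver (X : Frame ι) : turnOver (turnOver X) = X := by
  simp only [relabel_relabel]
  rw [show (swap 0 3 * swap 1 2 * (swap 0 3 * swap 1 2) : Perm (Fin 4)) = 1 by decide,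
    relabel_one]

/-- The basic convexity property of `midHeight`. -/
theorem IsVeering.midHeight_convex (h : τ.IsVeering α) {X : Frame ι} (hX : τ.Mid α X) :
    τ.midHeight α (turnOver (τ.rot (turnOver X))) + τ.midHeight α (τ.rot⁻¹ X) + 1 ≤
      τ.midHeight α X + τ.midHeight α (τ.rot⁻¹ (turnOver (τ.rot (turnOver X)))) := by
  set A := turnOver (τ.rot (turnOver X)) with hA
  have hρ := h.mid_turnOver hX
  -- The increment of the height along the fan is the remaining length of the crossing fan.
  have e1 : τ.midHeight α X = τ.ahead α (turnOver X) + τ.midHeight α (τ.rot⁻¹ X) := by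
    rw [midHeight_eq_height hX.1 hX.2.1, h.height_eq_add hX.2.2,
      midHeight_eq_height hX.2.2 (by rw [apply_inv_apply]; exact hX.1)]
  -- Passing from `X` to `A` is one step along the crossing fan, so that remaining length drops by
  -- exactly one.
  have e2 := h.ahead_eq_succ hρ.2.1
  by_cases hm : τ.Mid α A
  · have e3 : τ.midHeight α A = τ.ahead α (turnOver A) + τ.midHeight α (τ.rot⁻¹ A) := by
      rw [midHeight_eq_height hm.1 hm.2.1, h.height_eq_add hm.2.2,
        midHeight_eq_height hm.2.2 (by rw [apply_inv_apply]; exact hm.1)]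
    rw [hA, turnOver_turnOver, ← hA] at e3
    omega
  · rw [midHeight_of_not_mid hm]
    -- Here the height of `A` is set to 0, so the increment at `A` is at most 0, while `e2` makes
    -- the one at `X` at least 1.
    omega

end IdealTriangulation

namespace OrientedGluing

variable {ι : Type*} (τ : OrientedGluing ι)

theorem relabel_cross_congr {π ρ : Perm (Fin 4)} {k l : Fin 4} (hπ : π = ρ) (hk : k = l)
    (X : Frame ι) : relabel π (τ.cross k X) = relabel ρ (τ.cross l X) := by
  rw [hπ, hk]

theorem relabel_cross_cross_congr {π ρ : Perm (Fin 4)} {k l m n : Fin 4} (hπ : π = ρ)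
    (hk : k = l) (hm : m = n) (X : Frame ι) :
    relabel π (τ.cross k (τ.cross m X)) = relabel ρ (τ.cross l (τ.cross n X)) := by
  rw [hπ, hk, hm]

end OrientedGluing

/-- The half turn of a frame that exchanges its edge with the opposite one. -/
abbrev Frame.opposite {ι : Type*} (X : Frame ι) : Frame ι := relabel (swap 0 2 * swap 1 3) X

/-! ### Weights of edges and their convexity. -/

namespace IdealTriangulation

variable {ι : Type*} [Fintype ι] {τ : IdealTriangulation ι} {α : AngleVector ι}

open Classical in
/-- The total height of the fans of length one at an edge. -/
noncomputable def weight (τ : IdealTriangulation ι) (α : AngleVector ι) (e : τ.Edge) : ℕ :=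
  ∑ Q : Frame ι with τ.edge Q = e, τ.midHeight α (relabel (swap 0 3) Q)

/-- If both neighbours of `Q` coincided, the rotation orbit would be {Q, rot Q} with `Q` thin,
leaving room for only one flat frame. -/
theorem IsVeering.rot_ne_rot_inv (h : τ.IsVeering α) {Q : Frame ι}
    (hQ : τ.Mid α (relabel (swap 0 3) Q)) : τ.rot Q ≠ τ.rot⁻¹ Q := by
  intro he
  obtain ⟨hv, -, -⟩ := h.alone_of_mid hQ
  have h2 : τ.rot (τ.rot Q) = Q := by rw [he, apply_inv_apply]
  obtain ⟨k, hk, hne⟩ := h.exists_flat_ne (τ.rot Q)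
  have key : ∀ k : ℕ, (τ.rot ^ k) (τ.rot Q) = τ.rot Q ∨ (τ.rot ^ k) (τ.rot Q) = Q := by
    intro k
    induction k with
    | zero => exact Or.inl rfl
    | succ k ih =>
      rw [pow_succ', mul_apply]
      rcases ih with ih | ih <;> rw [ih]
      · exact Or.inr h2
      · exact Or.inl rfl
  rcases key k with h3 | h3
  · exact hne h3
  · rw [h3] at hk
    exact h.not_flat_of_valid hv hk

theorem IsVeering.flat_of_not_valid_rot (h : τ.IsVeering α) {Q : Frame ι} (hQ : Q.Valid α)
    (hr : ¬ (τ.rot Q).Valid α) : (τ.rot Q).Flat α := by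
  by_contra hF
  exact hr (h.flat_or_valid (by rw [τ.edge_rot, τ.sgn_rot, h.colour_edge hQ]) hF)

theorem IsVeering.flat_of_not_valid_rot_inv (h : τ.IsVeering α) {Q : Frame ι} (hQ : Q.Valid α)
    (hr : ¬ (τ.rot⁻¹ Q).Valid α) : (τ.rot⁻¹ Q).Flat α := by
  by_contra hF
  exact hr (h.flat_or_valid (by rw [τ.edge_rot_inv, τ.sgn_rot_inv, h.colour_edge hQ]) hF)

/-- The frames that are alone in their fans are next to every flat frame at the same edge. -/
theorem IsVeering.eq_of_flat (h : τ.IsVeering α) {Q Z : Frame ι}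
    (hQ : τ.Mid α (relabel (swap 0 3) Q)) (hZ : Z.Flat α) (he : τ.edge Q = τ.edge Z)
    (hs : τ.colour α (τ.edge Z) = Z.sgn) :
    Q = τ.rot Z ∨ Q = τ.rot⁻¹ Z ∨ Q = flip (τ.rot Z) ∨ Q = flip (τ.rot⁻¹ Z) := by
  obtain ⟨hv, h1, h2⟩ := h.alone_of_mid hQ
  have f1 := h.flat_of_not_valid_rot hv h1
  have f2 := h.flat_of_not_valid_rot_inv hv h2
  have hsgn : Z.sgn = Q.sgn := by rw [← hs, ← he, h.colour_edge hv]
  have hne : (τ.rot Q).tetEdge ≠ (τ.rot⁻¹ Q).tetEdge := by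
    rw [Ne, tetEdge_eq_iff (by rw [τ.sgn_rot, τ.sgn_rot_inv]), not_or]
    refine ⟨h.rot_ne_rot_inv hQ, fun h3 => ?_⟩
    rw [← τ.rot_flip] at h3
    exact OrientedGluing.flip_ne Q (τ.rot.injective h3).symm
  rcases h.eq_or_eq_of_flat f1 f2 hZ hne (by rw [τ.edge_rot, he]) (by rw [τ.edge_rot_inv, he])
    with h3 | h3
  · rcases (tetEdge_eq_iff (by rw [τ.sgn_rot, hsgn])).1 h3 with rfl | rfl
    · right; left
      rw [inv_apply_apply]
    · right; right; left
      rw [τ.rot_flip, inv_apply_apply, OrientedGluing.flip_flip]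
  · rcases (tetEdge_eq_iff (by rw [τ.sgn_rot_inv, hsgn])).1 h3 with rfl | rfl
    · left
      rw [apply_inv_apply]
    · right; right; right
      rw [τ.rot_inv_flip, apply_inv_apply, OrientedGluing.flip_flip]

open Classical in
theorem sum_le_of_subset_four {β : Type*} (s : Finset β) (f : β → ℕ) (a b c d : β)
    (h : ∀ x ∈ s, f x ≠ 0 → x = a ∨ x = b ∨ x = c ∨ x = d) :
    ∑ x ∈ s, f x ≤ f a + f b + f c + f d := by
  have hins : ∀ (x : β) (t : Finset β), ∑ y ∈ insert x t, f y ≤ f x + ∑ y ∈ t, f y := by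
    intro x t
    by_cases hx : x ∈ t
    · rw [Finset.insert_eq_of_mem hx]
      exact Nat.le_add_left _ _
    · rw [Finset.sum_insert hx]
  have h1 : ∑ x ∈ s, f x ≤ ∑ x ∈ ({a, b, c, d} : Finset β), f x := by
    rw [← Finset.sum_filter_ne_zero]
    apply Finset.sum_le_sum_of_subset
    intro x hx
    rw [Finset.mem_filter] at hx
    simpa using h x hx.1 hx.2
  have h2 := hins a {b, c, d}
  have h3 := hins b {c, d}
  have h4 := hins c {d}
  rw [Finset.sum_singleton] at h4
  omega

/-- A fan of length one fills the gap between the two flat angles of the edge, so every frame with a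
nonzero term is next to `Z`, up to changing the tip. -/
theorem IsVeering.weight_le (h : τ.IsVeering α) {Z : Frame ι} (hZ : Z.Flat α)
    (hs : τ.colour α (τ.edge Z) = Z.sgn) :
    τ.weight α (τ.edge Z) ≤ τ.midHeight α (relabel (swap 0 3) (τ.rot Z))
      + τ.midHeight α (relabel (swap 0 3) (τ.rot⁻¹ Z))
      + τ.midHeight α (relabel (swap 0 3) (flip (τ.rot Z)))
      + τ.midHeight α (relabel (swap 0 3) (flip (τ.rot⁻¹ Z))) := by
  classical
  apply sum_le_of_subset_four _ (fun Q => τ.midHeight α (relabel (swap 0 3) Q))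
  intro Q hQ hne
  have hm : τ.Mid α (relabel (swap 0 3) Q) := by
    by_contra hm
    exact hne (midHeight_of_not_mid hm)
  exact h.eq_of_flat hm hZ (by simpa using hQ) hs

/-- The first two frames are the two tips of one fan of length one. The other two lie just beyond
its flat neighbours; if the second fan also has length one, taking a flip in just one of them yields
both of its tips. Distinctness of the four is what allows them to be counted together. -/
theorem IsVeering.le_weight (h : τ.IsVeering α) {Q : Frame ι}
    (hQ : τ.Mid α (relabel (swap 0 3) Q)) :
    τ.midHeight α (relabel (swap 0 3) Q) + τ.midHeight α (relabel (swap 0 3) (flip Q))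
      + τ.midHeight α (relabel (swap 0 3) (flip (τ.rot (τ.rot Q))))
      + τ.midHeight α (relabel (swap 0 3) (τ.rot⁻¹ (τ.rot⁻¹ Q))) ≤ τ.weight α (τ.edge Q) := by
  classical
  have h1 : τ.rot (τ.rot Q) ≠ Q := by
    intro he
    apply h.rot_ne_rot_inv hQ
    rw [← inv_apply_apply τ.rot (τ.rot Q), he]
  have h2 : τ.rot⁻¹ (τ.rot⁻¹ Q) ≠ Q := by
    intro he
    apply h1
    rw [← he]
    simp only [apply_inv_apply]
    exact he.symm
  have n1 : Q ≠ flip Q := (OrientedGluing.flip_ne Q).symm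
  have n2 : Q ≠ flip (τ.rot (τ.rot Q)) := by
    intro he
    apply OrientedGluing.flip_ne (τ.rot Q)
    have h3 := congrArg τ.rot he
    rw [τ.rot_flip, inv_apply_apply] at h3
    exact h3.symm
  have n3 : flip Q ≠ τ.rot⁻¹ (τ.rot⁻¹ Q) := by
    intro he
    have h3 := congrArg τ.rot he
    rw [τ.rot_flip, apply_inv_apply] at h3
    exact OrientedGluing.flip_ne _ h3
  have n4 : flip Q ≠ flip (τ.rot (τ.rot Q)) := fun he => h1 (relabel_injective _ he).symm
  have n5 : flip (τ.rot (τ.rot Q)) ≠ τ.rot⁻¹ (τ.rot⁻¹ Q) := by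
    intro he
    rw [← τ.rot_inv_flip, ← τ.rot_inv_flip] at he
    exact n1 (τ.rot⁻¹.injective (τ.rot⁻¹.injective he)).symm
  have hsub : ({Q, flip Q, flip (τ.rot (τ.rot Q)), τ.rot⁻¹ (τ.rot⁻¹ Q)} : Finset (Frame ι)) ⊆
      Finset.univ.filter fun R => τ.edge R = τ.edge Q := by
    intro R hR
    simp only [Finset.mem_insert, Finset.mem_singleton] at hR
    rw [Finset.mem_filter]
    refine ⟨Finset.mem_univ _, ?_⟩
    rcases hR with rfl | rfl | rfl | rfl <;>
      simp only [τ.edge_flip, τ.edge_rot, τ.edge_rot_inv]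
  refine le_trans (le_of_eq ?_) (Finset.sum_le_sum_of_subset
    (f := fun R => τ.midHeight α (relabel (swap 0 3) R)) hsub)
  rw [Finset.sum_insert (by
      simp only [Finset.mem_insert, Finset.mem_singleton, n1, n2, h2.symm, or_self,
        not_false_eq_true]),
    Finset.sum_insert (by
      simp only [Finset.mem_insert, Finset.mem_singleton, n3, n4, or_self, not_false_eq_true]),
    Finset.sum_pair n5]
  ring

theorem IsVeering.weight_le_mul (h : τ.IsVeering α) (e : τ.Edge) :
    τ.weight α e ≤ 4 * τ.maxFanLength α ^ 2 := by
  obtain ⟨Z, hZ, rfl, hs⟩ := h.exists_flat e (τ.colour α e)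
  have h1 := h.weight_le hZ hs.symm
  have h2 := h.midHeight_le (relabel (swap 0 3) (τ.rot Z))
  have h3 := h.midHeight_le (relabel (swap 0 3) (τ.rot⁻¹ Z))
  have h4 := h.midHeight_le (relabel (swap 0 3) (flip (τ.rot Z)))
  have h5 := h.midHeight_le (relabel (swap 0 3) (flip (τ.rot⁻¹ Z)))
  omega

/-- The bound for the weight of the last edge of a frame in the interior of a fan. -/
theorem IsVeering.weight_last_le (h : τ.IsVeering α) {X : Frame ι} (hX : τ.Mid α X) :
    τ.weight α (τ.edge (relabel (swap 1 3) X)) ≤ τ.midHeight α (turnOver (τ.rot X))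
      + τ.midHeight α (τ.rot⁻¹ (opposite X)) + τ.midHeight α (τ.rot⁻¹ (flip X))
      + τ.midHeight α (turnOver (τ.rot (turnOver X))) := by
  have hc := (h.mid_iff.1 hX).2.1
  -- Validity of `X` is flatness of this frame at 03, and interiority of `X` supplies the colour.
  -- The four neighbours of the flat frame are then rewritten as the frames occurring in
  -- `midHeight_convex`.
  have h1 := h.weight_le (Z := relabel (swap 1 3) X) hX.1
    (by rw [hc, sgn_relabel, sign_swap (by decide), mul_neg_one])
  have e1 : relabel (swap 0 3) (τ.rot (relabel (swap 1 3) X)) = turnOver (τ.rot X) := by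
    simp only [τ.rot_apply, τ.cross_relabel, relabel_relabel]
    exact τ.relabel_cross_congr (by decide) (by decide) X
  have e2 : relabel (swap 0 3) (τ.rot⁻¹ (relabel (swap 1 3) X)) = τ.rot⁻¹ (opposite X) := by
    simp only [τ.rot_inv_apply, τ.cross_relabel, relabel_relabel]
    exact τ.relabel_cross_congr (by decide) (by decide) X
  have e3 : relabel (swap 0 3) (flip (τ.rot (relabel (swap 1 3) X))) = τ.rot⁻¹ (flip X) := by
    simp only [τ.rot_apply, τ.rot_inv_apply, τ.cross_relabel, relabel_relabel]
    exact τ.relabel_cross_congr (by decide) (by decide) X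
  have e4 : relabel (swap 0 3) (flip (τ.rot⁻¹ (relabel (swap 1 3) X)))
      = turnOver (τ.rot (turnOver X)) := by
    simp only [τ.rot_apply, τ.rot_inv_apply, τ.cross_relabel, relabel_relabel]
    exact τ.relabel_cross_congr (by decide) (by decide) X
  rwa [e1, e2, e3, e4] at h1

/-- The bound for the weight of one of the other edges of a frame in the interior of a fan. -/
theorem IsVeering.le_weight_side (h : τ.IsVeering α) {X : Frame ι} (hX : τ.Mid α X) :
    τ.midHeight α X + τ.midHeight α (opposite X)
      + τ.midHeight α (τ.rot⁻¹ (turnOver (τ.rot X)))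
      + τ.midHeight α (τ.rot⁻¹ (turnOver (τ.rot (opposite X))))
      ≤ τ.weight α (τ.edge (relabel (swap 0 3) X)) := by
  have e0 : relabel (swap 0 3) (relabel (swap 0 3) X) = X := by
    rw [relabel_relabel, swap_mul_self, relabel_one]
  have h1 := h.le_weight (Q := relabel (swap 0 3) X) (by rwa [e0])
  have e1 : relabel (swap 0 3) (flip (relabel (swap 0 3) X)) = opposite X := by
    simp only [relabel_relabel]
    congr 1
    decide
  have e2 : relabel (swap 0 3) (flip (τ.rot (τ.rot (relabel (swap 0 3) X))))
      = τ.rot⁻¹ (turnOver (τ.rot X)) := by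
    simp only [τ.rot_apply, τ.rot_inv_apply, τ.cross_relabel, relabel_relabel]
    exact τ.relabel_cross_cross_congr (by decide) (by decide) (by decide) X
  have e3 : relabel (swap 0 3) (τ.rot⁻¹ (τ.rot⁻¹ (relabel (swap 0 3) X)))
      = τ.rot⁻¹ (turnOver (τ.rot (opposite X))) := by
    simp only [τ.rot_apply, τ.rot_inv_apply, τ.cross_relabel, relabel_relabel]
    exact τ.relabel_cross_cross_congr (by decide) (by decide) (by decide) X
  rwa [e0, e1, e2, e3] at h1

/-- The convexity of heights is applied at the four frames X, `flip X`, `turnOver X` and `opposite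
X`. The sixteen heights involved are exactly those in two upper bounds for the π-edges 03, 12 and
two lower bounds for 02, 13. The four units of strictness give the 4. -/
theorem IsVeering.weight_convex (h : τ.IsVeering α) {X : Frame ι} (hX : τ.Mid α X) :
    τ.weight α (τ.edge (relabel (swap 1 3) X)) + τ.weight α (τ.edge (relabel (swap 0 2) X)) + 4
      ≤ τ.weight α (τ.edge (relabel (swap 1 2) X)) + τ.weight α (τ.edge (relabel (swap 0 3) X)) := by
  have r1 : turnOver (flip X) = opposite X := by
    simp only [relabel_relabel]; congr 1; decide
  have r2 : flip (turnOver X) = opposite X := by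
    simp only [relabel_relabel]; congr 1; decide
  have r3 : turnOver (opposite X) = flip X := by
    simp only [relabel_relabel]; congr 1; decide
  have r4 : flip (opposite X) = turnOver X := by
    simp only [relabel_relabel]; congr 1; decide
  have r5 : opposite (opposite X) = X := by
    simp only [relabel_relabel]
    conv_rhs => rw [← relabel_one X]
    congr 1
    decide
  have r6 : opposite (turnOver X) = flip X := by
    simp only [relabel_relabel]; congr 1; decide
  have m1 := mid_flip hX
  have m2 := h.mid_turnOver hX
  have m3 : τ.Mid α (opposite X) := r1 ▸ h.mid_turnOver m1
  have u1 := h.weight_last_le hX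
  have u2 := h.weight_last_le m3
  have l1 := h.le_weight_side hX
  have l2 := h.le_weight_side m2
  have c0 := h.midHeight_convex hX
  have c1 := h.midHeight_convex m1
  have c2 := h.midHeight_convex m2
  have c3 := h.midHeight_convex m3
  rw [relabel_relabel, τ.edge_relabel_congr (π := swap 0 2 * swap 1 3 * swap 1 3)
    (ρ := swap 0 2) (by decide), r3, r4, r5] at u2
  rw [relabel_relabel, τ.edge_relabel_congr (π := swap 0 3 * swap 1 2 * swap 0 3)
    (ρ := swap 1 2) (by decide), r6] at l2
  rw [r1] at c1
  rw [turnOver_turnOver] at c2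
  rw [r3] at c3
  omega

end IdealTriangulation

/-! ### Fan lengths and edge degrees. -/

namespace IdealTriangulation

variable {ι : Type*} [Fintype ι] {τ : IdealTriangulation ι} {α : AngleVector ι}

theorem IsTautAngleStructure.exists_valid [Nonempty ι] (h : τ.IsTautAngleStructure α) :
    ∃ X : Frame ι, X.Valid α := by
  obtain ⟨i⟩ := ‹Nonempty ι›
  by_cases hF : Frame.Flat α (i, 1)
  · exact ⟨_, (valid_relabel_iff_flat (π := swap 1 3) (by decide)).2 hF⟩
  · rcases h.valid_or hF with hv | hv
    exacts [⟨_, hv⟩, ⟨_, hv⟩]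

theorem IsVeering.exists_valid_of_thinCorner (h : τ.IsVeering α) (x : τ.ThinCorner α) :
    ∃ X : Frame ι, X.Valid α ∧ X.corner = x.1 := by
  obtain ⟨X, hX⟩ := exists_corner x.1
  have hF : ¬ X.Flat α := by
    intro hF
    have h1 : X.angle α = 0 := by
      have := x.2
      rw [← hX] at this
      exact this
    rw [Flat, h1] at hF
    exact Real.pi_ne_zero hF.symm
  rcases h.valid_or hF with hv | hv
  · exact ⟨X, hv, hX⟩
  · exact ⟨_, hv, by rw [corner_mirror, hX]⟩

omit [Fintype ι] in
theorem thinCorner_ne_of_flat {X : Frame ι} (hX : X.Flat α) (y : τ.ThinCorner α) :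
    y.1 ≠ X.corner := by
  intro he
  have h1 := y.2
  rw [he] at h1
  exact Real.pi_ne_zero (hX.symm.trans h1)

/-- Every fan starts at some frame, and has as many corners as frames follow. -/
theorem IsVeering.exists_first (h : τ.IsVeering α) (F : τ.Fan α) :
    ∃ X : Frame ι, X.Valid α ∧ (τ.rot⁻¹ X).Flat α ∧ τ.fanLength α F ≤ τ.ahead α X + 1 := by
  classical
  obtain ⟨x₀, rfl⟩ := Quot.exists_rep F
  obtain ⟨X₀, hX₀, hc₀⟩ := h.exists_valid_of_thinCorner x₀
  set m := τ.ahead α (flip X₀) with hm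
  have hback : ∀ k ≤ m, ((τ.rot⁻¹ ^ k) X₀).Valid α := by
    intro k hk
    have := valid_of_le_ahead (τ := τ) (valid_flip.2 hX₀) hk
    rwa [τ.rot_pow_flip, valid_flip] at this
  set X := (τ.rot⁻¹ ^ m) X₀ with hX
  have hXv : X.Valid α := hback m le_rfl
  have hXi : (τ.rot⁻¹ X).Flat α := by
    apply h.flat_of_not_valid_rot_inv hXv
    have := h.not_valid_ahead (flip X₀)
    rwa [τ.rot_pow_flip, valid_flip, pow_succ', mul_apply] at this
  refine ⟨X, hXv, hXi, ?_⟩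
  have hend : (τ.rot ((τ.rot ^ τ.ahead α X) X)).Flat α := by
    apply h.flat_of_not_valid_rot (valid_of_le_ahead hXv le_rfl)
    have := h.not_valid_ahead X
    rwa [pow_succ', mul_apply] at this
  -- These corners are closed under adjacency among thin corners, as the corners just before and
  -- just after them are flat; so they contain the whole fan.
  set C : τ.ThinCorner α → Prop :=
    fun x => ∃ k ≤ τ.ahead α X, x.1 = ((τ.rot ^ k) X).corner with hC
  have hpow : ∀ k ≤ m, (τ.rot ^ k) X = (τ.rot⁻¹ ^ (m - k)) X₀ := by
    intro k hk
    rw [hX, inv_pow, inv_pow, ← mul_apply]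
    congr 1
    rw [mul_inv_eq_iff_eq_mul, ← mul_left_cancel_iff (a := τ.rot ^ (m - k)), ← pow_add,
      mul_inv_cancel_left, Nat.sub_add_cancel hk]
  have hC₀ : C x₀ := by
    refine ⟨m, ?_, by rw [hpow m le_rfl]; simpa using hc₀.symm⟩
    -- Otherwise the first frame after the end of the fan would still lie in the valid stretch
    -- leading to `X₀`.
    by_contra! hlt
    apply h.not_valid_ahead X
    rw [hpow _ hlt]
    exact hback _ (Nat.sub_le _ _)
  have hstep : ∀ x y : τ.ThinCorner α, τ.CornerStep x.1 y.1 → C x → C y := by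
    rintro x y hxy ⟨k, hk, hx⟩
    rw [hx] at hxy
    rcases τ.eq_corner_of_cornerStep hxy with hy | hy
    · rcases hk.lt_or_eq with hlt | rfl
      · exact ⟨k + 1, hlt, by rw [hy, pow_succ', mul_apply]⟩
      · exact absurd hy (thinCorner_ne_of_flat hend y)
    · cases k with
      | zero => exact absurd hy (thinCorner_ne_of_flat hXi y)
      | succ k =>
        refine ⟨k, by omega, ?_⟩
        rw [hy, pow_succ', mul_apply, inv_apply_apply]
  have hgen : ∀ x y : τ.ThinCorner α,
      Relation.EqvGen (fun x y : τ.ThinCorner α => τ.CornerStep x.1 y.1) x y → (C x ↔ C y) := by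
    intro x y hxy
    induction hxy with
    | rel x y hxy => exact ⟨hstep x y hxy, hstep y x (τ.cornerStep_symm hxy)⟩
    | refl x => rfl
    | symm x y _ ih => exact ih.symm
    | trans x y z _ _ ih1 ih2 => exact ih1.trans ih2
  have hall : ∀ x : {x : τ.ThinCorner α // τ.fanOf α x = Quot.mk _ x₀}, C x.1 :=
    fun x => (hgen _ _ (Quot.eqvGen_exact x.2)).2 hC₀
  choose k hk hkc using hall
  have hinj : Function.Injective fun x => (⟨k x, Nat.lt_succ_of_le (hk x)⟩ :
      Fin (τ.ahead α X + 1)) := by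
    intro x y hxy
    have h1 : k x = k y := congrArg Fin.val hxy
    apply Subtype.ext
    apply Subtype.ext
    rw [hkc x, hkc y, h1]
  have := Nat.card_le_card_of_injective _ hinj
  rwa [Nat.card_fin] at this

/-- The frames of a fan, together with the flat frames before and after it and one more frame,
lie at distinct tetrahedron edges. -/
theorem IsVeering.ahead_add_four_le (h : τ.IsVeering α) {X : Frame ι} (hX : X.Valid α)
    (hX' : (τ.rot⁻¹ X).Flat α) : τ.ahead α X + 4 ≤ τ.degree (τ.edge X) := by
  classical
  set n := τ.ahead α X with hn
  set Y := τ.rot⁻¹ X with hY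
  have hsucc : ∀ k, (τ.rot ^ (k + 1)) Y = (τ.rot ^ k) X := by
    intro k
    rw [pow_succ, mul_apply, hY, apply_inv_apply]
  have hmid : ∀ k, 1 ≤ k → k ≤ n + 1 → ¬ ((τ.rot ^ k) Y).Flat α := by
    intro k h1 h2
    obtain ⟨k, rfl⟩ := Nat.exists_eq_add_of_le' h1
    rw [hsucc]
    exact h.not_flat_of_valid (valid_of_le_ahead hX (by omega))
  have hend : ((τ.rot ^ (n + 2)) Y).Flat α := by
    rw [hsucc, pow_succ', mul_apply]
    apply h.flat_of_not_valid_rot (valid_of_le_ahead hX le_rfl)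
    have := h.not_valid_ahead X
    rwa [pow_succ', mul_apply] at this
  have hend' : ¬ ((τ.rot ^ (n + 3)) Y).Flat α := by
    rw [pow_succ', mul_apply]
    exact h.not_flat_rot hend
  -- A return to the flat frame `Y` within this range can happen only at the second flat frame, `n +
  -- 2`. Then the orbit would contain a single flat frame.
  have hper : ∀ p, 1 ≤ p → p ≤ n + 3 → (τ.rot ^ p) Y ≠ Y := by
    intro p h1 h2 hp
    have hp' : ((τ.rot ^ p) Y).Flat α := by rwa [hp]
    have hpn : p = n + 2 := by
      by_contra hne
      rcases Nat.lt_or_ge p (n + 2) with hlt | hge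
      · exact hmid p h1 (by omega) hp'
      · obtain rfl : p = n + 3 := by omega
        exact hend' hp'
    obtain ⟨k, hk, hne⟩ := h.exists_flat_ne Y
    have hmul : ∀ m : ℕ, (τ.rot ^ (p * m)) Y = Y := by
      intro m
      induction m with
      | zero => simp
      | succ m ih => rw [Nat.mul_succ, pow_add, mul_apply, hp, ih]
    rw [← Nat.mod_add_div k p, pow_add, mul_apply, hmul] at hk hne
    have hlt := Nat.mod_lt k h1
    rcases Nat.eq_zero_or_pos (k % p) with h0 | h0
    · rw [h0] at hne
      exact hne rfl
    · exact hmid _ h0 (by omega) hk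
  have hinj : ∀ a b, a < b → b ≤ n + 3 →
      ((τ.rot ^ a) Y).tetEdge ≠ ((τ.rot ^ b) Y).tetEdge := by
    intro a b hab hb he
    have hadd : (τ.rot ^ b) Y = (τ.rot ^ (b - a)) ((τ.rot ^ a) Y) := by
      rw [← mul_apply (τ.rot ^ (b - a)), ← pow_add, Nat.sub_add_cancel hab.le]
    rcases (tetEdge_eq_iff (by rw [sgn_rot_pow, sgn_rot_pow])).1 he.symm with h1 | h1
    · apply hper (b - a) (by omega) (by omega)
      apply (τ.rot ^ a).injective
      rw [← mul_apply, ← pow_add, Nat.add_sub_cancel' hab.le, h1]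
    · rw [hadd] at h1
      exact τ.rot_pow_ne_flip _ _ h1
  let f : Fin (n + 4) → {x : TetEdge ι // τ.edgeOf x = τ.edge X} := fun k =>
    ⟨((τ.rot ^ (k : ℕ)) Y).tetEdge, by
      change τ.edge ((τ.rot ^ (k : ℕ)) Y) = τ.edge X
      rw [edge_rot_pow, hY, τ.edge_rot_inv]⟩
  have hf : Function.Injective f := by
    intro a b hab
    have h1 : ((τ.rot ^ (a : ℕ)) Y).tetEdge = ((τ.rot ^ (b : ℕ)) Y).tetEdge :=
      congrArg Subtype.val hab
    have ha := a.2
    have hb := b.2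
    rcases lt_trichotomy (a : ℕ) b with hlt | heq | hlt
    · exact absurd h1 (hinj _ _ hlt (by omega))
    · exact Fin.ext heq
    · exact absurd h1.symm (hinj _ _ hlt (by omega))
  have := Nat.card_le_card_of_injective f hf
  rwa [Nat.card_fin] at this

theorem IsVeering.maxFanLength_add_three_le [Nonempty ι] (h : τ.IsVeering α) :
    τ.maxFanLength α + 3 ≤ τ.maxDegree := by
  classical
  have : Finite (τ.ThinCorner α) := inferInstanceAs (Finite {x : Corner ι // cornerAngle α x = 0})
  have : Finite (τ.Fan α) :=
    Finite.of_surjective (τ.fanOf α) (fun F => Quot.inductionOn F fun x => ⟨x, rfl⟩)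
  have : Finite τ.Edge :=
    Finite.of_surjective τ.edgeOf (fun e => Quot.inductionOn e fun x => ⟨x, rfl⟩)
  obtain ⟨X, hX⟩ := h.exists_valid
  have : Nonempty (τ.Fan α) := ⟨τ.fanOf α ⟨X.corner, h.cornerAngle_eq_zero hX⟩⟩
  obtain ⟨F, hF⟩ := exists_eq_ciSup_of_finite (f := fun F : τ.Fan α => τ.fanLength α F)
  obtain ⟨Y, hY, hY', hle⟩ := h.exists_first F
  have h1 := h.ahead_add_four_le hY hY'
  have h2 : τ.degree (τ.edge Y) ≤ τ.maxDegree :=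
    le_ciSup (f := fun e : τ.Edge => τ.degree e) (Set.finite_range _).bddAbove (τ.edge Y)
  have h3 : τ.fanLength α F = τ.maxFanLength α := hF
  omega

/-! ### Positive growth of thin angles and the angle structure. -/

/-- The positive weight of an edge. -/
noncomputable def posWeight (τ : IdealTriangulation ι) (α : AngleVector ι) (e : τ.Edge) : ℝ :=
  1 / 2 + τ.weight α e / (8 * (τ.maxFanLength α : ℝ) ^ 2)

/-- The weight of an edge with the sign given by its colour. -/
noncomputable def signedWeight (τ : IdealTriangulation ι) (α : AngleVector ι) (e : τ.Edge) : ℝ :=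
  ((τ.colour α e : ℤ) : ℝ) * τ.posWeight α e

theorem half_le_posWeight (e : τ.Edge) : 1 / 2 ≤ τ.posWeight α e := by
  unfold posWeight
  have : (0 : ℝ) ≤ τ.weight α e / (8 * (τ.maxFanLength α : ℝ) ^ 2) := by positivity
  linarith

theorem IsVeering.posWeight_le_one (h : τ.IsVeering α) (hd : 1 ≤ τ.maxFanLength α) (e : τ.Edge) :
    τ.posWeight α e ≤ 1 := by
  unfold posWeight
  have hd' : (0 : ℝ) < 8 * (τ.maxFanLength α : ℝ) ^ 2 := by positivity
  have h1 : (τ.weight α e : ℝ) ≤ 4 * (τ.maxFanLength α : ℝ) ^ 2 := by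
    exact_mod_cast h.weight_le_mul e
  have h2 : τ.weight α e / (8 * (τ.maxFanLength α : ℝ) ^ 2) ≤ 1 / 2 := by
    rw [div_le_iff₀ hd']
    linarith
  linarith

theorem IsVeering.abs_signedWeight_le_one (h : τ.IsVeering α) (hd : 1 ≤ τ.maxFanLength α)
    (e : τ.Edge) : |τ.signedWeight α e| ≤ 1 := by
  have h1 := half_le_posWeight (α := α) e
  have h2 := h.posWeight_le_one hd e
  rw [signedWeight, abs_le]
  rcases Int.units_eq_one_or (τ.colour α e) with hc | hc <;> rw [hc] <;> push_cast <;>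
    constructor <;> linarith

/-- The edges 02 and 13 always contribute positively. If a π-edge also does, the range [1/2, 1] of
the weights leaves at least 1/2; otherwise the frame is interior to its fan and the convexity of
weights applies. -/
theorem IsVeering.le_turn (h : τ.IsVeering α) (hd : 1 ≤ τ.maxFanLength α) {X : Frame ι}
    (hX : X.Valid α) :
    1 / (2 * (τ.maxFanLength α : ℝ) ^ 2) ≤ τ.turn (τ.signedWeight α) X := by
  have hd' : (1 : ℝ) ≤ (τ.maxFanLength α : ℝ) ^ 2 := by
    have : (1 : ℝ) ≤ τ.maxFanLength α := by exact_mod_cast hd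
    exact one_le_pow₀ this
  have hsmall : 1 / (2 * (τ.maxFanLength α : ℝ) ^ 2) ≤ 1 / 2 := by
    rw [div_le_div_iff₀ (by positivity) (by norm_num)]
    linarith
  have c12 := h.colour_swap hX
  have c03 := h.colour_swap (X := turnOver X) ((valid_relabel (by decide)).2 hX)
  rw [relabel_relabel, sgn_relabel, show sign (swap 0 3 * swap 1 2 : Perm (Fin 4)) = 1 by decide,
    mul_one, τ.edge_relabel_congr (π := swap 0 3 * swap 1 2 * swap 1 2) (ρ := swap 0 3)
      (by decide)] at c03
  have hmid := h.mid_iff (X := X)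
  have hconv := h.weight_convex (X := X)
  unfold OrientedGluing.turn signedWeight
  rw [c12, c03]
  set e13 := τ.edge (relabel (swap 1 3) X)
  set e02 := τ.edge (relabel (swap 0 2) X)
  set e12 := τ.edge (relabel (swap 1 2) X)
  set e03 := τ.edge (relabel (swap 0 3) X)
  have l13 := half_le_posWeight (α := α) e13
  have l02 := half_le_posWeight (α := α) e02
  have l12 := half_le_posWeight (α := α) e12
  have l03 := half_le_posWeight (α := α) e03
  have u13 := h.posWeight_le_one hd e13
  have u02 := h.posWeight_le_one hd e02
  have hboth : τ.colour α e13 = - X.sgn → τ.colour α e02 = - X.sgn →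
      1 / (2 * (τ.maxFanLength α : ℝ) ^ 2) ≤
        τ.posWeight α e12 + τ.posWeight α e03 - τ.posWeight α e13 - τ.posWeight α e02 := by
    intro h1 h2
    have h3 : (τ.weight α e13 : ℝ) + τ.weight α e02 + 4 ≤ τ.weight α e12 + τ.weight α e03 := by
      exact_mod_cast hconv (hmid.2 ⟨hX, h1, h2⟩)
    unfold posWeight
    -- The numerator 4 is the gap in `weight_convex`; the constants 1/2 cancel.
    have h4 : 1 / (2 * (τ.maxFanLength α : ℝ) ^ 2) = 4 / (8 * (τ.maxFanLength α : ℝ) ^ 2) := by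
      field_simp
      norm_num
    have h5 : 4 / (8 * (τ.maxFanLength α : ℝ) ^ 2) ≤
        ((τ.weight α e12 : ℝ) + τ.weight α e03 - τ.weight α e13 - τ.weight α e02) /
          (8 * (τ.maxFanLength α : ℝ) ^ 2) := by
      gcongr
      linarith
    rw [sub_div, sub_div, add_div] at h5
    linarith
  generalize 1 / (2 * (τ.maxFanLength α : ℝ) ^ 2) = K at hsmall hboth ⊢
  rcases Int.units_eq_one_or X.sgn with hs | hs <;>
    rcases Int.units_eq_one_or (τ.colour α e13) with h1 | h1 <;>
    rcases Int.units_eq_one_or (τ.colour α e02) with h2 | h2 <;>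
    rw [hs, h1, h2] at hboth <;> rw [hs, h1, h2] <;> simp at hboth ⊢ <;> linarith

/-- A veering triangulation has a positive angle structure whose angles are bounded below in terms
of the largest length of a fan. -/
theorem IsVeering.exists_isPositiveAngleStructure [Nonempty ι] (hα : τ.IsVeering α) :
    ∃ θ : AngleVector ι, τ.IsPositiveAngleStructure θ ∧
      ∀ i q, Real.pi / (12 * (τ.maxFanLength α : ℝ) ^ 2) ≤ θ i q := by
  classical
  obtain ⟨X₀, hX₀⟩ := hα.exists_valid
  have hd : 1 ≤ τ.maxFanLength α := (Nat.le_add_left _ _).trans (hα.ahead_lt hX₀)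
  have hd1 : (1 : ℝ) ≤ τ.maxFanLength α := by exact_mod_cast hd
  have hd' : (1 : ℝ) ≤ (τ.maxFanLength α : ℝ) ^ 2 := one_le_pow₀ hd1
  have hpi := Real.pi_pos
  set w := τ.signedWeight α with hw
  -- Flat angles decrease at rate at most 4, so the step π/6 leaves them at least π/3, and it turns
  -- the rate 1/(2d²) of thin angles into π/(12d²).
  set θ : AngleVector ι := fun i q => α i q + Real.pi / 6 * τ.deformation w i q with hθ
  have hθX : ∀ X : Frame ι, X.angle θ = X.angle α + Real.pi / 6 * τ.turn w X := by
    intro X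
    rw [← τ.deformation_oppPair]
    rfl
  have hsmall : Real.pi / (12 * (τ.maxFanLength α : ℝ) ^ 2) ≤ Real.pi / 12 := by
    apply div_le_div_of_nonneg_left hpi.le (by norm_num)
    linarith
  have hvalid : ∀ X : Frame ι, X.Valid α →
      Real.pi / (12 * (τ.maxFanLength α : ℝ) ^ 2) ≤ X.angle θ := by
    intro X hX
    have h1 := hα.le_turn hd hX
    rw [hθX, hα.angle_eq_zero (hα.not_flat_of_valid hX), zero_add]
    calc Real.pi / (12 * (τ.maxFanLength α : ℝ) ^ 2)
        = Real.pi / 6 * (1 / (2 * (τ.maxFanLength α : ℝ) ^ 2)) := by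
          field_simp
          norm_num
      _ ≤ _ := by gcongr
  have hbound : ∀ X : Frame ι, Real.pi / (12 * (τ.maxFanLength α : ℝ) ^ 2) ≤ X.angle θ := by
    intro X
    by_cases hF : X.Flat α
    · have h1 : -4 ≤ τ.turn w X := by
        have b1 := abs_le.1 (hα.abs_signedWeight_le_one hd (τ.edge (relabel (swap 1 3) X)))
        have b2 := abs_le.1 (hα.abs_signedWeight_le_one hd (τ.edge (relabel (swap 0 2) X)))
        have b3 := abs_le.1 (hα.abs_signedWeight_le_one hd (τ.edge (relabel (swap 1 2) X)))
        have b4 := abs_le.1 (hα.abs_signedWeight_le_one hd (τ.edge (relabel (swap 0 3) X)))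
        unfold OrientedGluing.turn
        rcases Int.units_eq_one_or X.sgn with hs | hs <;> rw [hs] <;> push_cast <;> linarith
      rw [Flat] at hF
      rw [hθX, hF]
      have h2 : Real.pi / 6 * (-4) ≤ Real.pi / 6 * τ.turn w X :=
        mul_le_mul_of_nonneg_left h1 (by positivity)
      linarith
    · rcases hα.valid_or hF with hv | hv
      · exact hvalid X hv
      · rw [← relabel_one X, X.angle_relabel_congr θ (ρ := swap 2 3) (by decide)]
        exact hvalid _ hv
  have hall : ∀ i q, Real.pi / (12 * (τ.maxFanLength α : ℝ) ^ 2) ≤ θ i q := by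
    intro i q
    have h1 := hbound (i, stdPerm q)
    rwa [Frame.angle, oppPair_stdPerm] at h1
  refine ⟨θ, ⟨⟨fun i => ?_, fun e => ?_⟩, fun i q => lt_of_lt_of_le (by positivity) (hall i q)⟩,
    hall⟩
  · simp only [hθ, Finset.sum_add_distrib, ← Finset.mul_sum, τ.sum_deformation, hα.tetrahedron i]
    ring
  · have h1 := τ.sum_deformation_edge w e
    have h2 := hα.edge e
    simp only [hθ, Finset.sum_add_distrib, ← Finset.mul_sum, h1, h2]
    ring

end IdealTriangulation

end VeeringTriangulation

theorem theorem1p2 {ι : Type*} [Fintype ι] [Nonempty ι]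
    (τ : VeeringTriangulation.IdealTriangulation ι)
    (α : VeeringTriangulation.AngleVector ι) (hα : τ.IsVeering α) :
    ∃ θ : VeeringTriangulation.AngleVector ι,
      τ.IsPositiveAngleStructure θ ∧
      (∀ i q, Real.pi / (12 * (τ.maxFanLength α : ℝ) ^ 2) ≤ θ i q) ∧
      Real.pi / (12 * ((τ.maxDegree : ℝ) - 3) ^ 2) ≤
        Real.pi / (12 * (τ.maxFanLength α : ℝ) ^ 2) := by
  obtain ⟨X₀, hX₀⟩ := hα.exists_valid
  obtain ⟨θ, hθ, hle⟩ := hα.exists_isPositiveAngleStructure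
  refine ⟨θ, hθ, hle, ?_⟩
  have hd : (0 : ℝ) < τ.maxFanLength α := by
    exact_mod_cast (Nat.succ_pos _).trans_le (hα.ahead_lt hX₀)
  have hdeg : (τ.maxFanLength α : ℝ) + 3 ≤ τ.maxDegree := by
    exact_mod_cast hα.maxFanLength_add_three_le
  have hle' : (τ.maxFanLength α : ℝ) ≤ τ.maxDegree - 3 := by linarith
  apply div_le_div_of_nonneg_left Real.pi_pos.le (by positivity)
  gcongr
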